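/- Let $\sqrt n=2^p$ with $p\in\mathbb N$, and let $\tau_0=\{1\},\ \tau_1=\{2\},\ \tau_2=\{3,4\},\dots,\tau_p=\{\sqrt n/2+1,\dots,\sqrt n\}$ be the dyadic partition of $\{1,\dots,\sqrt n\}$, with $j(k)=j$ for $k\in\tau_j$. Identify $\{1,\dots,n\}$ with $\{1,\dots,\sqrt n\}^2$, where $(k,l)$ lies on the $k$-th horizontal line and in the $l$-th vertical column. For $S\subset\{1,\dots,n\}$ put $$s^c_\ell=\max_{0\le \ell'\le p}\ \max_{k\in\tau_{\ell'}}\bigl|S\cap(\tau_\ell\times\tau_{\ell'})\cap C_k\bigr|,\qquad 0\le\ell\le p,$$ where $C_k$ is the $k$-th vertical column. Let $\mathcal F\in\mathbb C^{\sqrt n\times\sqrt n}$ be the unitary discrete Fourier transform, whose rows are the frequencies $-\sqrt n/2<\omega\le\sqrt n/2$ in the order $0,1,-1,2,-2,\dots$. Let $\psi\in\mathbb C^{\sqrt n\times\sqrt n}$ be the discrete Shannon wavelet transform: $(\psi x)_u=\langle x,\psi_u\rangle$, where $$\psi_u(t)=n^{-1/4}\sum_{\omega\in\mathbb Z}c_u(\omega)\,e^{2\pi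 i\omega t/\sqrt n},\qquad 0\le t<\sqrt n ,$$ with $c_1=\mathbf 1_{\{0\}}$ and, for $u=2^j+r+1$ with $0\le j<p$ and $0\le r<2^j$, $c_u(\omega)=2^{-j/2}\,\mathbf 1_{(-1,-1/2]\cup(1/2,1]}(\omega/2^j)\,e^{-2\pi i\omega r/2^j}$. Let $A_0=(\mathcal F\otimes\mathcal F)(\psi\otimes\psi)^*\in\mathbb C^{n\times n}$ be the product of the 2D Fourier transform with the inverse 2D Shannon wavelet transform, and for $1\le k\le\sqrt n$ let the block $B_k\in\mathbb C^{\sqrt n\times n}$ consist of the rows of $A_0$ on the $k$-th horizontal line. For a probability distribution $\pi$ on $\{1,\dots,\sqrt n\}$ let $$A=\frac1{\sqrt m}\Bigl(\frac1{\sqrt{\pi_{K_\ell}}}B_{K_\ell}\Bigr)_{1\le\ell\le m},\qquad K_1,\dots,K_m\ \text{i.i.d.},\quad \mathbb P(K_\ell=k)=\pi_k .$$ There is a universal constant $C>0$ such that the following holds for all $p$, all $S\subset\{1,\dots,n\}$ with $s=|S|\ge2$, all $x\in\mathbb C^n$ supported on $S$, and all $\varepsilon\in(0,1)$. 1. Let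 $\pi$ be constant by level, $\pi_k=\tilde\pi_{j(k)}$, with $\tilde\pi_j>0$ whenever $s^c_j>0$. If $$m\ \ge\ C\,\max_{0\le j\le p}\frac{2^{-j}}{\tilde\pi_j}\,s^c_j\ \ln(s)\,\ln\!\left(\frac n\varepsilon\right)$$ (terms with $s^c_j=0$ being read as $0$), then with probability larger than $1-\varepsilon$ the vector $x$ is the unique solution of $\min\{\|z\|_1:\ z\in\mathbb C^n,\ Az=Ax\}$. 2. The weights $\tilde\pi_j=\dfrac{s^c_j2^{-j}}{\sum_{k=1}^{\sqrt n}s^c_{j(k)}2^{-j(k)}}$ define a probability distribution $\pi_k=\tilde\pi_{j(k)}$ on the lines, and for this distribution the same conclusion holds as soon as $$m\ \ge\ C\,\sum_{j=0}^p s^c_j\ \ln(s)\,\ln\!\left(\frac n\varepsilon\right).$$ -/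

import Mathlib

open scoped BigOperators Matrix

namespace ShannonMRI

noncomputable section

/-! Throughout, an image has side `√n = 2 ^ p`. Indices are `0`-based: `u : Fin (2 ^ p)` stands for
the index `u + 1` of `{1, …, √n}`. -/

/-- The level function `j(u)` of the dyadic partition
`τ_0 = {1}, τ_1 = {2}, τ_2 = {3, 4}, …, τ_p = {√n / 2 + 1, …, √n}` of `{1, …, √n}`.
For the `0`-based index, `j(u)` is the number of binary digits of `u`. -/
def level {p : ℕ} (u : Fin (2 ^ p)) : Fin (p + 1) :=
  ⟨Nat.size u, Nat.lt_succ_of_le (Nat.size_le.2 u.isLt)⟩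

/-- The dyadic set `τ_j`. -/
def tau {p : ℕ} (j : Fin (p + 1)) : Finset (Fin (2 ^ p)) :=
  Finset.univ.filter fun u => level u = j

/-! ### Fourier transform and Shannon wavelet transform -/

/-- The enumeration `0, 1, -1, 2, -2, 3, …` of the frequencies. -/
def freq (k : ℕ) : ℤ := if Even k then -((k / 2 : ℕ) : ℤ) else ((k + 1) / 2 : ℕ)

/-- The unitary 1D discrete Fourier transform of `ℂ^(2 ^ p)`, the frequencies
`-2 ^ p / 2 < ω ≤ 2 ^ p / 2` being listed in the order `0, 1, -1, 2, -2, …`. -/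
def fourier1D (p : ℕ) : Matrix (Fin (2 ^ p)) (Fin (2 ^ p)) ℂ := fun k t =>
  ((1 / Real.sqrt (2 ^ p) : ℝ) : ℂ) *
    Complex.exp (-(2 * Real.pi * Complex.I * (freq k : ℂ) * ((t : ℕ) : ℂ) / 2 ^ p))

/-- The Fourier transform `∫ f(t) exp(-2πi ξ t) dt` of the Shannon scaling function
`f(t) = sinc t = sin (π t) / (π t)`. Here and below the values at the endpoints are chosen so
that the dyadic frequency bands partition `ℤ`. -/
def scalingHat : ℝ → ℂ := Set.indicator (Set.Ioc (-(1 / 2)) (1 / 2)) 1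

/-- The Fourier transform of the Shannon mother wavelet `f(t) = 2 sinc (2 t) - sinc t`. -/
def motherHat : ℝ → ℂ := Set.indicator (Set.Ioc (-1) (-(1 / 2)) ∪ Set.Ioc (1 / 2) 1) 1

/-- The Fourier coefficient at `ω` of the `u`-th element of the `1`-periodic Shannon wavelet basis.
For `u = 0` this is the periodization of the scaling function. For `u = 2 ^ j + r` with
`0 ≤ r < 2 ^ j` it is the periodization of `t ↦ 2 ^ (j / 2) f (2 ^ j t - r)`, with `f` the mother
wavelet. -/
def waveletCoeff (u : ℕ) (ω : ℤ) : ℂ :=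
  if u = 0 then scalingHat ω
  else
    ((1 / Real.sqrt (2 ^ Nat.log 2 u) : ℝ) : ℂ) * motherHat ((ω : ℝ) / 2 ^ Nat.log 2 u) *
      Complex.exp (-(2 * Real.pi * Complex.I * (ω : ℂ) * ((u - 2 ^ Nat.log 2 u : ℕ) : ℂ) /
        2 ^ Nat.log 2 u))

/-- The `u`-th discrete Shannon wavelet in `ℂ^(2 ^ p)`: the periodic wavelet (given by its Fourier
series, all of whose nonzero coefficients have `|ω| ≤ 2 ^ p`) sampled at the points `t / 2 ^ p` and
normalized. -/
def shannonWavelet (p : ℕ) (u t : Fin (2 ^ p)) : ℂ :=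
  ((1 / Real.sqrt (2 ^ p) : ℝ) : ℂ) *
    ∑ ω ∈ Finset.Icc (-(2 ^ p : ℤ)) (2 ^ p),
      waveletCoeff u ω * Complex.exp (2 * Real.pi * Complex.I * (ω : ℂ) * ((t : ℕ) : ℂ) / 2 ^ p)

/-- The 1D Shannon wavelet transform: it maps a signal to its inner products with the wavelets. -/
def shannon1D (p : ℕ) : Matrix (Fin (2 ^ p)) (Fin (2 ^ p)) ℂ := fun u t =>
  star (shannonWavelet p u t)

/-- The 2D Fourier transform. -/
def fourier2D (p : ℕ) : Matrix (Fin (2 ^ p) × Fin (2 ^ p)) (Fin (2 ^ p) × Fin (2 ^ p)) ℂ :=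
  Matrix.kronecker (fourier1D p) (fourier1D p)

/-- The 2D (separable) Shannon wavelet transform; its inverse is its conjugate transpose. -/
def shannon2D (p : ℕ) : Matrix (Fin (2 ^ p) × Fin (2 ^ p)) (Fin (2 ^ p) × Fin (2 ^ p)) ℂ :=
  Matrix.kronecker (shannon1D p) (shannon1D p)

/-- The full sampling matrix `A₀`: 2D Fourier transform times inverse 2D Shannon wavelet transform.
The index `(k, l)` is the pixel on the `k`-th horizontal line and in the `l`-th vertical column. -/
def A₀ (p : ℕ) : Matrix (Fin (2 ^ p) × Fin (2 ^ p)) (Fin (2 ^ p) × Fin (2 ^ p)) ℂ :=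
  fourier2D p * (shannon2D p)ᴴ

/-! ### Sampling of horizontal lines and recovery -/

/-- The block `B_k`: the rows of `A₀` on the `k`-th horizontal line. -/
def block (p : ℕ) (k : Fin (2 ^ p)) : Matrix (Fin (2 ^ p)) (Fin (2 ^ p) × Fin (2 ^ p)) ℂ :=
  fun i c => A₀ p (k, i) c

/-- The sensing matrix `A = m^(-1/2) (π_{K_l}^(-1/2) B_{K_l})_{l}` for the drawn lines `K`. -/
def sensing {p m : ℕ} (π : Fin (2 ^ p) → ℝ) (K : Fin m → Fin (2 ^ p)) :
    Matrix (Fin m × Fin (2 ^ p)) (Fin (2 ^ p) × Fin (2 ^ p)) ℂ := fun li c =>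
  ((1 / Real.sqrt m * (1 / Real.sqrt (π (K li.1))) : ℝ) : ℂ) * block p (K li.1) li.2 c

/-- The `ℓ¹` norm. -/
def l1norm {ι : Type*} [Fintype ι] (z : ι → ℂ) : ℝ := ∑ i, ‖z i‖

/-- `x` is the unique solution of `min ‖z‖₁` subject to `A z = y`. -/
def IsUniqueL1Solution {ι κ : Type*} [Fintype ι] (A : Matrix κ ι ℂ) (y : κ → ℂ) (x : ι → ℂ) :
    Prop :=
  A *ᵥ x = y ∧ ∀ z : ι → ℂ, A *ᵥ z = y → z ≠ x → l1norm x < l1norm z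

/-- `K_1, …, K_m` are i.i.d. with `P(K_l = k) = π_k`. -/
structure IsIIDWithLaw {Ω : Type*} [MeasurableSpace Ω] (μ : MeasureTheory.Measure Ω) {p m : ℕ}
    (π : Fin (2 ^ p) → ℝ) (K : Fin m → Ω → Fin (2 ^ p)) : Prop where
  measurable : ∀ l, Measurable (K l)
  indep : ProbabilityTheory.iIndepFun K μ
  law : ∀ l k, μ.real (K l ⁻¹' {k}) = π k

/-! ### Structured sparsity -/

/-- `Ω_{ℓ, ℓ'} = τ_ℓ × τ_ℓ'`. -/
def Omega {p : ℕ} (ℓ ℓ' : Fin (p + 1)) : Finset (Fin (2 ^ p) × Fin (2 ^ p)) := tau ℓ ×ˢ tau ℓ'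

/-- The `k`-th vertical column `C_k`. -/
def column {p : ℕ} (k : Fin (2 ^ p)) : Finset (Fin (2 ^ p) × Fin (2 ^ p)) :=
  Finset.univ ×ˢ {k}

/-- `s^c_ℓ = max_{ℓ'} max_{k ∈ τ_ℓ'} |S ∩ Ω_{ℓ, ℓ'} ∩ C_k|`. -/
def sc {p : ℕ} (S : Finset (Fin (2 ^ p) × Fin (2 ^ p))) (ℓ : Fin (p + 1)) : ℕ :=
  Finset.univ.sup fun ℓ' : Fin (p + 1) => (tau ℓ').sup fun k => (S ∩ Omega ℓ ℓ' ∩ column k).card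

/-- A drawing probability that is constant by level, given by its values `w_j` on the levels. -/
def byLevel {p : ℕ} (w : Fin (p + 1) → ℝ) : Fin (2 ^ p) → ℝ := fun k => w (level k)

/-- `w` gives a probability distribution on the lines. -/
def IsLevelDistribution {p : ℕ} (w : Fin (p + 1) → ℝ) : Prop :=
  (∀ j, 0 ≤ w j) ∧ ∑ k, byLevel w k = 1

/-- The weights proportional to `s^c_j 2^(-j)`, normalized over the lines. -/
def adaptedWeights {p : ℕ} (S : Finset (Fin (2 ^ p) × Fin (2 ^ p))) (j : Fin (p + 1)) : ℝ :=
  ((sc S j : ℝ) / 2 ^ (j : ℕ)) /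
    ∑ k : Fin (2 ^ p), (sc S (level k) : ℝ) / 2 ^ (level k : ℕ)

end

end ShannonMRI

open ShannonMRI

open ShannonMRI

namespace ShannonMRI

open MeasureTheory ProbabilityTheory

/-! The Shannon wavelets of one scale occupy exactly one dyadic frequency band, so the
one-dimensional Fourier-wavelet matrix U = `waveletMatrix p` is unitary and block diagonal along the
levels τ_j, with squared entries at most 2·2^(-j). As `A₀` is the Kronecker product of U with
itself, a horizontal line at level j sees only the part of each column of S that lies at level j,
and this part has at most s^c_j points.

Put H_k = B_k^* B_k / π_k and let G be the maximum in the sampling condition. For z supported on S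
with sup norm at most b, `lineOperator_bounds` shows that H_K z has mean z, entries at most 2Gb and
coordinatewise second moments at most 2Gb². By Bernstein, the mean over a batch of q samples is
within b/4 of z at any given coordinate, except with probability 4 exp(-q/(512 G)).

The golfing scheme iterates this over about log₂ s disjoint batches: the residual on S shrinks by
1/4 at each step, and the accumulated vector is orthogonal to the kernel of A and at most 1/2 off S.
It is run from the sign pattern of x and also from every unit vector at a point of S. The
unit-vector certificates bound a kernel vector on S by its mass off S, in place of a conditioning
estimate for A on S (`l1norm_lt_of_certificates`). All estimates are in sup norm, so a union bound
over starting vectors, steps and coordinates suffices.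

For the adapted weights, every nonzero term of the maximum equals the normalizing sum, which is at
most ∑ s^c_j. -/

theorem sum_range_exp (N : ℕ) (hN : 0 < N) (d : ℤ) :
    ∑ t ∈ Finset.range N, Complex.exp (2 * Real.pi * Complex.I * (d : ℂ) * (t : ℂ) / N) =
      if (N : ℤ) ∣ d then (N : ℂ) else 0 := by
  have hN' : (N : ℂ) ≠ 0 := by exact_mod_cast hN.ne'
  have hpow (t : ℕ) : Complex.exp (2 * Real.pi * Complex.I * (d : ℂ) * (t : ℂ) / N) =
      Complex.exp (2 * Real.pi * Complex.I * (d : ℂ) / N) ^ t := by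
    rw [← Complex.exp_nat_mul]; congr 1; ring
  simp only [hpow]
  have hone : Complex.exp (2 * Real.pi * Complex.I * (d : ℂ) / N) = 1 ↔ (N : ℤ) ∣ d := by
    rw [Complex.exp_eq_one_iff]
    have h2 : (2 * Real.pi * Complex.I : ℂ) ≠ 0 := Complex.two_pi_I_ne_zero
    constructor
    · rintro ⟨c, hc⟩
      refine ⟨c, ?_⟩
      rw [div_eq_iff hN'] at hc
      have : (2 * Real.pi * Complex.I : ℂ) * d = (2 * Real.pi * Complex.I : ℂ) * (N * c) := by
        rw [hc]; ring
      exact_mod_cast mul_left_cancel₀ h2 this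
    · rintro ⟨c, rfl⟩
      refine ⟨c, ?_⟩
      push_cast
      field_simp
  split_ifs with h
  · rw [hone.2 h]; simp
  · rw [geom_sum_eq (mt hone.1 h), ← Complex.exp_nat_mul]
    have : (N : ℂ) * (2 * Real.pi * Complex.I * (d : ℂ) / N) = d * (2 * Real.pi * Complex.I) := by
      field_simp
    rw [this, Complex.exp_int_mul_two_pi_mul_I]; simp

/-! ### Dyadic bands and the one-dimensional Fourier-wavelet matrix -/

theorem natSize_eq_log_add_one {u : ℕ} (hu : u ≠ 0) : Nat.size u = Nat.log 2 u + 1 :=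
  le_antisymm (Nat.size_le.2 (Nat.lt_pow_succ_log_self one_lt_two u))
    (Nat.lt_size.2 (Nat.pow_log_le_self 2 hu))

theorem freq_bounds {k N : ℕ} (h : k < N) : -(N : ℤ) < 2 * freq k ∧ 2 * freq k ≤ N := by
  unfold freq
  split_ifs with hk
  · omega
  · rw [Nat.not_even_iff] at hk; omega

theorem freq_eq_zero_iff {k : ℕ} : freq k = 0 ↔ k = 0 := by
  unfold freq
  split_ifs with hk
  · rw [Nat.even_iff] at hk; omega
  · rw [Nat.not_even_iff] at hk; omega

/-- Positive and negative frequencies alternate in the enumeration, so a symmetric dyadic band fills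
a contiguous run of line indices. This matches wavelet scales with levels of lines. -/
theorem freq_mem_band_iff (k Q : ℕ) :
    ((-(Q : ℤ) < freq k ∧ 2 * freq k ≤ -Q) ∨ ((Q : ℤ) < 2 * freq k ∧ freq k ≤ Q)) ↔
      Q ≤ k ∧ k < 2 * Q := by
  unfold freq
  split_ifs with hk
  · rw [Nat.even_iff] at hk; omega
  · rw [Nat.not_even_iff] at hk; omega

/-- The band is (Q/2, Q] together with the translate by -Q of (0, Q/2], hence a complete residue
system modulo Q. -/
theorem eq_of_dvd_freq_sub {k k' Q : ℕ} (h : Q ≤ k) (h2 : k < 2 * Q) (h' : Q ≤ k')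
    (h2' : k' < 2 * Q) (hd : (Q : ℤ) ∣ freq k - freq k') : k = k' := by
  obtain ⟨c, hc⟩ := hd
  have key (hl : -2 * (Q : ℤ) < freq k - freq k') (hu : freq k - freq k' < 2 * Q) :
      freq k - freq k' = 0 ∨ freq k - freq k' = Q ∨ freq k - freq k' = -Q := by
    have hQ : (0 : ℤ) < Q := by omega
    rw [hc] at hl hu ⊢
    have h1 : c < 2 := by nlinarith
    have h3 : -2 < c := by nlinarith
    have : c = 0 ∨ c = 1 ∨ c = -1 := by omega
    rcases this with rfl | rfl | rfl <;> simp
  clear hc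
  unfold freq at key
  split_ifs at key with hk hk' hk' <;> (try rw [Nat.not_even_iff] at hk) <;>
    (try rw [Nat.not_even_iff] at hk') <;> (try rw [Nat.even_iff] at hk) <;>
    (try rw [Nat.even_iff] at hk') <;> specialize key (by omega) (by omega) <;> omega

theorem scalingHat_intCast (ω : ℤ) : scalingHat ω = if ω = 0 then 1 else 0 := by
  unfold scalingHat
  rw [Set.indicator_apply]
  have : ((ω : ℝ) ∈ Set.Ioc (-(1 / 2) : ℝ) (1 / 2)) ↔ ω = 0 := by
    constructor
    · rintro ⟨h1, h2⟩
      have h1' : (-1 : ℝ) < ω := by linarith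
      have h2' : (ω : ℝ) < 1 := by linarith
      norm_cast at h1' h2'; omega
    · rintro rfl; norm_num
  simp only [this, Pi.one_apply]

theorem motherHat_div_two_pow (ω : ℤ) (j : ℕ) :
    motherHat ((ω : ℝ) / 2 ^ j) =
      if ((-((2 ^ j : ℕ) : ℤ) < ω ∧ 2 * ω ≤ -((2 ^ j : ℕ) : ℤ)) ∨
        (((2 ^ j : ℕ) : ℤ) < 2 * ω ∧ ω ≤ ((2 ^ j : ℕ) : ℤ))) then 1 else 0 := by
  unfold motherHat
  rw [Set.indicator_apply]
  have hpos : (0 : ℝ) < 2 ^ j := by positivity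
  refine if_congr ?_ rfl rfl
  rw [Set.mem_union, Set.mem_Ioc, Set.mem_Ioc, lt_div_iff₀ hpos, div_le_iff₀ hpos,
    lt_div_iff₀ hpos, div_le_iff₀ hpos]
  have e1 : (-1 * 2 ^ j : ℝ) < ω ↔ -((2 ^ j : ℕ) : ℤ) < ω := by
    rw [← @Int.cast_lt ℝ]; push_cast; rw [neg_one_mul]
  have e2 : (ω : ℝ) ≤ -(1 / 2) * 2 ^ j ↔ 2 * ω ≤ -((2 ^ j : ℕ) : ℤ) := by
    rw [← @Int.cast_le ℝ]; push_cast; constructor <;> intro h <;> linarith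
  have e3 : (1 / 2 * 2 ^ j : ℝ) < ω ↔ ((2 ^ j : ℕ) : ℤ) < 2 * ω := by
    rw [← @Int.cast_lt ℝ]; push_cast; constructor <;> intro h <;> linarith
  have e4 : (ω : ℝ) ≤ 1 * 2 ^ j ↔ ω ≤ ((2 ^ j : ℕ) : ℤ) := by
    rw [← @Int.cast_le ℝ]; push_cast; rw [one_mul]
  rw [e1, e2, e3, e4]

/-- The 1D Fourier transform times the inverse 1D Shannon wavelet transform. -/
noncomputable def waveletMatrix (p : ℕ) : Matrix (Fin (2 ^ p)) (Fin (2 ^ p)) ℂ :=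
  fun k u => waveletCoeff u (freq k)

/-- The scale of such a wavelet is at most half of 2^N, so its spectrum fits in the Nyquist window
and sampling at 2^N points causes no aliasing. -/
theorem waveletCoeff_eq_zero {u N : ℕ} (hu : u < 2 ^ N) {ω : ℤ}
    (hω : ¬(-(2 ^ N : ℤ) < 2 * ω ∧ 2 * ω ≤ 2 ^ N)) : waveletCoeff u ω = 0 := by
  have hN : (0 : ℤ) < 2 ^ N := by positivity
  unfold waveletCoeff
  split_ifs with h0
  · rw [scalingHat_intCast, if_neg]
    rintro rfl; exact hω (by constructor <;> linarith)
  · rw [motherHat_div_two_pow, if_neg, mul_zero, zero_mul]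
    have h1 : Nat.log 2 u < N := Nat.log_lt_of_lt_pow h0 hu
    have h2 : 2 * 2 ^ Nat.log 2 u ≤ 2 ^ N := by
      rw [← pow_succ']; exact Nat.pow_le_pow_right two_pos h1
    have h3 : 2 * ((2 ^ Nat.log 2 u : ℕ) : ℤ) ≤ 2 ^ N := by exact_mod_cast h2
    have h4 : 0 < ((2 ^ Nat.log 2 u : ℕ) : ℤ) := by positivity
    generalize ((2 ^ Nat.log 2 u : ℕ) : ℤ) = Q at *
    generalize (2 ^ N : ℤ) = M at *
    omega

/-- The discrete transform of the samples adds up the Fourier coefficients over a residue class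
modulo 2^p. Only the representative in the Nyquist window contributes, and that is `freq k`. -/
theorem fourier1D_mul_conjTranspose_shannon1D (p : ℕ) :
    fourier1D p * (shannon1D p)ᴴ = waveletMatrix p := by
  ext k u
  have hpos : 0 < 2 ^ p := by positivity
  have hsq : ((1 / Real.sqrt (2 ^ p) : ℝ) : ℂ) * ((1 / Real.sqrt (2 ^ p) : ℝ) : ℂ) *
      ((2 ^ p : ℕ) : ℂ) = 1 := by
    have : (1 / Real.sqrt (2 ^ p)) * (1 / Real.sqrt (2 ^ p)) * ((2 ^ p : ℕ) : ℝ) = 1 := by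
      have h : Real.sqrt (2 ^ p) * Real.sqrt (2 ^ p) = 2 ^ p := Real.mul_self_sqrt (by positivity)
      have h0 : Real.sqrt (2 ^ p) ≠ 0 := by positivity
      push_cast
      field_simp
      rw [sq, h]
    exact_mod_cast this
  have hterm (ω : ℤ) (t : ℕ) :
      Complex.exp (-(2 * Real.pi * Complex.I * (freq k : ℂ) * (t : ℂ) / 2 ^ p)) *
        Complex.exp (2 * Real.pi * Complex.I * (ω : ℂ) * (t : ℂ) / 2 ^ p) =
      Complex.exp (2 * Real.pi * Complex.I * ((ω - freq k : ℤ) : ℂ) * (t : ℂ) / (2 ^ p : ℕ)) := by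
    rw [← Complex.exp_add]; congr 1; push_cast; ring
  calc (fourier1D p * (shannon1D p)ᴴ) k u
      = ∑ t : Fin (2 ^ p), ((1 / Real.sqrt (2 ^ p) : ℝ) : ℂ) * ((1 / Real.sqrt (2 ^ p) : ℝ) : ℂ) *
          ∑ ω ∈ Finset.Icc (-(2 ^ p : ℤ)) (2 ^ p), waveletCoeff u ω *
            Complex.exp (2 * Real.pi * Complex.I * ((ω - freq k : ℤ) : ℂ) * ((t : ℕ) : ℂ) /
              (2 ^ p : ℕ)) := by
        rw [Matrix.mul_apply]
        refine Finset.sum_congr rfl fun t _ => ?_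
        simp only [Matrix.conjTranspose_apply, shannon1D, star_star, fourier1D, shannonWavelet,
          Finset.mul_sum, ← hterm]
        refine Finset.sum_congr rfl fun ω _ => ?_
        ring
    _ = ((1 / Real.sqrt (2 ^ p) : ℝ) : ℂ) * ((1 / Real.sqrt (2 ^ p) : ℝ) : ℂ) *
          ∑ ω ∈ Finset.Icc (-(2 ^ p : ℤ)) (2 ^ p), waveletCoeff u ω *
            (if ((2 ^ p : ℕ) : ℤ) ∣ ω - freq k then ((2 ^ p : ℕ) : ℂ) else 0) := by
        rw [← Finset.mul_sum, Finset.sum_comm]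
        congr 1
        refine Finset.sum_congr rfl fun ω _ => ?_
        rw [← Finset.mul_sum, ← sum_range_exp _ hpos, Finset.sum_range]
    _ = ((1 / Real.sqrt (2 ^ p) : ℝ) : ℂ) * ((1 / Real.sqrt (2 ^ p) : ℝ) : ℂ) *
          (waveletCoeff u (freq k) * ((2 ^ p : ℕ) : ℂ)) := by
        congr 1
        have hb := freq_bounds k.isLt
        have hP : (0 : ℤ) < ((2 ^ p : ℕ) : ℤ) := by positivity
        rw [Finset.sum_eq_single (freq k)]
        · simp
        · intro ω _ hne
          by_cases hω : -(2 ^ p : ℤ) < 2 * ω ∧ 2 * ω ≤ 2 ^ p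
          · rw [if_neg, mul_zero]
            rintro ⟨c, hc⟩
            have e : (2 ^ p : ℤ) = ((2 ^ p : ℕ) : ℤ) := by push_cast; rfl
            rw [e] at hω
            generalize ((2 ^ p : ℕ) : ℤ) = Q at *
            have h1 : c < 1 := by nlinarith
            have h2 : -1 < c := by nlinarith
            obtain rfl : c = 0 := by omega
            exact hne (by linarith)
          · rw [waveletCoeff_eq_zero u.isLt hω, zero_mul]
        · intro hn
          exfalso; apply hn
          rw [Finset.mem_Icc]
          push_cast at hb
          have : (0 : ℤ) < 2 ^ p := by positivity
          constructor <;> linarith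
    _ = waveletMatrix p k u := by
        rw [mul_comm (waveletCoeff _ _), ← mul_assoc, hsq, one_mul, waveletMatrix]

theorem A₀_apply (p : ℕ) (k i u v : Fin (2 ^ p)) :
    A₀ p (k, i) (u, v) = waveletMatrix p k u * waveletMatrix p i v := by
  have : A₀ p = Matrix.kronecker (waveletMatrix p) (waveletMatrix p) := by
    rw [← fourier1D_mul_conjTranspose_shannon1D]
    unfold A₀ fourier2D shannon2D Matrix.kronecker
    rw [Matrix.conjTranspose_kronecker, ← Matrix.mul_kronecker_mul]
  rw [this]; rfl

theorem waveletCoeff_freq_zero_left (k : ℕ) :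
    waveletCoeff 0 (freq k) = if k = 0 then 1 else 0 := by
  simp [waveletCoeff, scalingHat_intCast, freq_eq_zero_iff]

theorem waveletCoeff_freq {u k : ℕ} (hu : u ≠ 0) :
    waveletCoeff u (freq k) = if 2 ^ Nat.log 2 u ≤ k ∧ k < 2 * 2 ^ Nat.log 2 u then
      ((1 / Real.sqrt (2 ^ Nat.log 2 u) : ℝ) : ℂ) *
      Complex.exp (-(2 * Real.pi * Complex.I * (freq k : ℂ) * ((u - 2 ^ Nat.log 2 u : ℕ) : ℂ) /
        2 ^ Nat.log 2 u)) else 0 := by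
  simp only [waveletCoeff, if_neg hu, motherHat_div_two_pow, freq_mem_band_iff]
  split_ifs <;> simp

theorem two_pow_log_le_iff {u k : ℕ} :
    (2 ^ Nat.log 2 u ≤ k ∧ k < 2 * 2 ^ Nat.log 2 u) ↔ k ≠ 0 ∧ Nat.log 2 k = Nat.log 2 u := by
  rw [← pow_succ']
  constructor
  · intro h
    have : 0 < 2 ^ Nat.log 2 u := by positivity
    refine ⟨by omega, Nat.log_eq_of_pow_le_of_lt_pow h.1 h.2⟩
  · rintro ⟨h0, h⟩
    rw [← h]
    exact ⟨Nat.pow_log_le_self 2 h0, Nat.lt_pow_succ_log_self one_lt_two k⟩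

/-- Block diagonality: the band of a wavelet consists of the frequencies listed at its own level. -/
theorem waveletMatrix_eq_zero {p : ℕ} {k u : Fin (2 ^ p)} (h : level k ≠ level u) :
    waveletMatrix p k u = 0 := by
  have h' : Nat.size k ≠ Nat.size u := fun e => h (Fin.ext e)
  unfold waveletMatrix
  by_cases hu : (u : ℕ) = 0
  · rw [hu, waveletCoeff_freq_zero_left, if_neg]
    intro hk; exact h' (by rw [hu, hk])
  · rw [waveletCoeff_freq hu, if_neg]
    rw [two_pow_log_le_iff]
    rintro ⟨h0, h1⟩
    exact h' (by rw [natSize_eq_log_add_one h0, natSize_eq_log_add_one hu, h1])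

/-- The factor 2 comes from the level being one more than the scale exponent; the constant wavelet,
at level 0, satisfies the bound with room to spare. -/
theorem norm_waveletMatrix_sq_le {p : ℕ} (k u : Fin (2 ^ p)) :
    ‖waveletMatrix p k u‖ ^ 2 ≤ 2 * (1 / 2 ^ (level u : ℕ)) := by
  change ‖waveletCoeff u (freq k)‖ ^ 2 ≤ 2 * (1 / 2 ^ Nat.size u)
  by_cases hu : (u : ℕ) = 0
  · rw [hu, waveletCoeff_freq_zero_left]
    split_ifs <;> simp
  · rw [waveletCoeff_freq hu]
    rw [natSize_eq_log_add_one hu]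
    split_ifs
    · rw [norm_mul, Complex.norm_real, Complex.norm_exp]
      have : (-(2 * Real.pi * Complex.I * (freq k : ℂ) * ((u - 2 ^ Nat.log 2 u : ℕ) : ℂ) /
        2 ^ Nat.log 2 u)).re = 0 := by
        have : (-(2 * Real.pi * Complex.I * (freq k : ℂ) * ((u - 2 ^ Nat.log 2 u : ℕ) : ℂ) /
          2 ^ Nat.log 2 u)) =
          ((-(2 * Real.pi * (freq k : ℝ) * ((u - 2 ^ Nat.log 2 u : ℕ) : ℝ) /
          2 ^ Nat.log 2 u) : ℝ) : ℂ) * Complex.I := by push_cast; ring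
        rw [this, Complex.re_ofReal_mul, Complex.I_re, mul_zero]
      rw [this, Real.exp_zero, mul_one, Real.norm_eq_abs, sq_abs, div_pow, Real.sq_sqrt (by positivity)]
      rw [pow_succ]; apply le_of_eq; field_simp; ring
    · simp

/-- Rows of different levels have disjoint supports. Within a level, the inner product is a sum over
the 2^j translations of a character, which vanishes unless the two frequencies agree modulo 2^j; in
one band that forces equality. -/
theorem waveletMatrix_mul_conjTranspose (p : ℕ) :
    waveletMatrix p * (waveletMatrix p)ᴴ = 1 := by
  ext k k'
  rw [Matrix.mul_apply, Matrix.one_apply]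
  simp only [Matrix.conjTranspose_apply]
  by_cases hk : (k : ℕ) = 0
  · have hz (u : Fin (2 ^ p)) (hu : (u : ℕ) ≠ 0) : waveletMatrix p k u = 0 := by
      rw [waveletMatrix, waveletCoeff_freq hu, if_neg]
      rw [hk]
      have : 0 < 2 ^ Nat.log 2 (u : ℕ) := by positivity
      omega
    rw [Finset.sum_eq_single k]
    · simp only [waveletMatrix, hk, waveletCoeff_freq_zero_left]
      simp only [if_true, one_mul]
      by_cases h : k = k'
      · simp [← h, hk]
      · rw [if_neg h, if_neg, star_zero]
        intro h'; exact h (Fin.ext (by rw [hk, h']))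
    · intro u _ hne
      rw [hz u (fun h => hne (Fin.ext (by rw [h, hk]))), zero_mul]
    · simp
  · by_cases hl : level k' = level k
    · have hk' : (k' : ℕ) ≠ 0 := by
        intro h
        have : Nat.size (k' : ℕ) = Nat.size (k : ℕ) := congrArg Fin.val hl
        rw [h, Nat.size_zero, eq_comm, natSize_eq_log_add_one hk] at this
        omega
      have hlog : Nat.log 2 (k' : ℕ) = Nat.log 2 (k : ℕ) := by
        have : Nat.size (k' : ℕ) = Nat.size (k : ℕ) := congrArg Fin.val hl
        rw [natSize_eq_log_add_one hk, natSize_eq_log_add_one hk'] at this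
        omega
      set j := Nat.log 2 (k : ℕ) with hj
      have hkb : 2 ^ j ≤ (k : ℕ) ∧ (k : ℕ) < 2 * 2 ^ j := two_pow_log_le_iff.2 ⟨hk, hj.symm⟩
      have hkb' : 2 ^ j ≤ (k' : ℕ) ∧ (k' : ℕ) < 2 * 2 ^ j :=
        two_pow_log_le_iff.2 ⟨hk', hlog⟩
      have hpos : 0 < 2 ^ j := by positivity
      have hjp : 2 * 2 ^ j ≤ 2 ^ p := by
        rw [← pow_succ']
        exact Nat.pow_le_pow_right two_pos (Nat.log_lt_of_lt_pow hk k.isLt)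
      set f : ℕ → ℂ := fun u => waveletCoeff u (freq k) * star (waveletCoeff u (freq k')) with hf
      have hsum : ∑ u : Fin (2 ^ p), waveletMatrix p k u * star (waveletMatrix p k' u) =
          ∑ r ∈ Finset.range (2 ^ j), f (2 ^ j + r) := by
        have h1 : ∑ u : Fin (2 ^ p), waveletMatrix p k u * star (waveletMatrix p k' u) =
            ∑ u ∈ Finset.range (2 ^ p), f u := by
          rw [Finset.sum_range]; rfl
        have h2 : ∑ r ∈ Finset.range (2 ^ j), f (2 ^ j + r) =
            ∑ u ∈ Finset.Ico (2 ^ j) (2 * 2 ^ j), f u := by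
          rw [Finset.sum_Ico_eq_sum_range]
          congr 2; omega
        rw [h1, h2]
        symm
        refine Finset.sum_subset ?_ ?_
        · intro u hu
          rw [Finset.mem_Ico] at hu
          rw [Finset.mem_range]; omega
        · intro u _ hu
          rw [Finset.mem_Ico] at hu
          simp only [hf]
          rcases eq_or_ne u 0 with rfl | h0
          · rw [waveletCoeff_freq_zero_left, if_neg hk, zero_mul]
          · rw [waveletCoeff_freq h0, if_neg, zero_mul]
            rw [two_pow_log_le_iff]
            rintro ⟨-, h⟩
            exact hu (two_pow_log_le_iff.2 ⟨h0, h.symm⟩)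
      have hterm (r : ℕ) (hr : r < 2 ^ j) : f (2 ^ j + r) = (1 / (2 ^ j : ℕ) : ℂ) *
          Complex.exp (2 * Real.pi * Complex.I * ((freq k' - freq k : ℤ) : ℂ) * (r : ℂ) /
            (2 ^ j : ℕ)) := by
        have h0 : 2 ^ j + r ≠ 0 := by omega
        have hlg : Nat.log 2 (2 ^ j + r) = j :=
          Nat.log_eq_of_pow_le_of_lt_pow (by omega) (by rw [pow_succ']; omega)
        simp only [hf]
        rw [waveletCoeff_freq h0, waveletCoeff_freq h0, hlg, if_pos hkb, if_pos hkb',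
          Nat.add_sub_cancel_left, star_mul']
        have hs : ((1 / Real.sqrt (2 ^ j) : ℝ) : ℂ) * star ((1 / Real.sqrt (2 ^ j) : ℝ) : ℂ) =
            (1 / (2 ^ j : ℕ) : ℂ) := by
          have : (1 / Real.sqrt (2 ^ j)) * (1 / Real.sqrt (2 ^ j)) = 1 / 2 ^ j := by
            rw [div_mul_div_comm, Real.mul_self_sqrt (by positivity), one_mul]
          rw [Complex.star_def, Complex.conj_ofReal, ← Complex.ofReal_mul, this]
          push_cast; rfl
        rw [← hs, mul_mul_mul_comm]
        congr 1
        rw [Complex.star_def, ← Complex.exp_conj, ← Complex.exp_add]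
        congr 1
        simp only [map_neg, map_div₀, map_mul, Complex.conj_I, Complex.conj_ofReal, map_ofNat,
          map_pow, map_intCast, map_natCast]
        push_cast; ring
      rw [hsum, Finset.sum_congr rfl fun r hr => hterm r (Finset.mem_range.1 hr),
        ← Finset.mul_sum, sum_range_exp _ hpos]
      by_cases h : k = k'
      · subst h
        simp
      · rw [if_neg h, if_neg, mul_zero]
        intro hd
        exact h (Fin.ext (eq_of_dvd_freq_sub hkb'.1 hkb'.2 hkb.1 hkb.2 hd).symm)
    · rw [if_neg (by rintro rfl; exact hl rfl)]
      refine Finset.sum_eq_zero fun u _ => ?_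
      by_cases hu : level k = level u
      · rw [waveletMatrix_eq_zero (k := k') (fun h => hl (h.trans hu.symm)), star_zero, mul_zero]
      · rw [waveletMatrix_eq_zero hu, zero_mul]

theorem conjTranspose_mul_waveletMatrix (p : ℕ) :
    (waveletMatrix p)ᴴ * waveletMatrix p = 1 :=
  mul_eq_one_comm.1 (waveletMatrix_mul_conjTranspose p)

/-! ### Concentration for i.i.d. samples with values in a finite set -/

section Probability

variable {Ω : Type*} [MeasurableSpace Ω] {μ : Measure Ω} [IsProbabilityMeasure μ]
  {κ : Type*} [Fintype κ] [MeasurableSpace κ] [MeasurableSingletonClass κ]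

theorem integral_comp_eq_sum {X : Ω → κ} (hX : Measurable X) (g : κ → ℝ) :
    ∫ ω, g (X ω) ∂μ = ∑ k, μ.real (X ⁻¹' {k}) * g k := by
  have hg : Measurable g := measurable_of_finite g
  have := Measure.isProbabilityMeasure_map (μ := μ) hX.aemeasurable
  rw [← integral_map (f := g) hX.aemeasurable hg.aestronglyMeasurable,
    integral_fintype Integrable.of_finite]
  refine Finset.sum_congr rfl fun k _ => ?_
  rw [map_measureReal_apply hX (measurableSet_singleton k), smul_eq_mul]

theorem sum_measureReal_preimage {X : Ω → κ} (hX : Measurable X) :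
    ∑ k, μ.real (X ⁻¹' {k}) = 1 := by
  have := integral_comp_eq_sum (μ := μ) hX (fun _ => 1)
  simpa using this.symm

/-- Combines exp y ≤ 1 + y + y² for |y| ≤ 1, averaged over the law, with 1 + y ≤ exp y. -/
theorem mgf_comp_le {X : Ω → κ} (hX : Measurable X) {π : κ → ℝ}
    (hπ : ∀ k, μ.real (X ⁻¹' {k}) = π k) {g : κ → ℝ} {t V : ℝ}
    (hg : ∀ k, |t * g k| ≤ 1) (hV : ∑ k, π k * g k ^ 2 ≤ V) :
    mgf (g ∘ X) μ t ≤ Real.exp (t * ∑ k, π k * g k + t ^ 2 * V) := by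
  have hsum : ∑ k, π k = 1 := by simpa only [hπ] using sum_measureReal_preimage (μ := μ) hX
  calc mgf (g ∘ X) μ t = ∑ k, π k * Real.exp (t * g k) := by
        have := integral_comp_eq_sum (μ := μ) hX (fun k => Real.exp (t * g k))
        simpa only [hπ, mgf, Function.comp_apply] using this
    _ ≤ ∑ k, (π k + t * (π k * g k) + t ^ 2 * (π k * g k ^ 2)) := by
        refine Finset.sum_le_sum fun k _ => ?_
        have h0 : 0 ≤ π k := by rw [← hπ]; exact measureReal_nonneg
        have h1 := (abs_le.1 (Real.abs_exp_sub_one_sub_id_le (hg k))).2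
        have : Real.exp (t * g k) ≤ 1 + t * g k + (t * g k) ^ 2 := by linarith
        calc π k * Real.exp (t * g k) ≤ π k * (1 + t * g k + (t * g k) ^ 2) :=
              mul_le_mul_of_nonneg_left this h0
          _ = _ := by ring
    _ = (t * ∑ k, π k * g k + t ^ 2 * ∑ k, π k * g k ^ 2) + 1 := by
        rw [Finset.sum_add_distrib, Finset.sum_add_distrib, ← Finset.mul_sum, ← Finset.mul_sum,
          hsum]
        ring
    _ ≤ (t * ∑ k, π k * g k + t ^ 2 * V) + 1 := by gcongr
    _ ≤ _ := Real.add_one_le_exp _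

theorem bernstein_tail {m : ℕ} {K : Fin m → Ω → κ} (hK : ∀ l, Measurable (K l))
    (hind : iIndepFun K μ) {π : κ → ℝ} (hπ : ∀ l k, μ.real (K l ⁻¹' {k}) = π k)
    {g : κ → ℝ} {Γ b : ℝ} (hΓ : 0 < Γ) (hb : 0 < b) (hg : ∀ k, |g k| ≤ Γ * b)
    (hV : ∑ k, π k * g k ^ 2 ≤ Γ * b ^ 2) (T : Finset (Fin m)) :
    μ.real {ω | (T.card : ℝ) * (∑ k, π k * g k + b / 8) ≤ ∑ l ∈ T, g (K l ω)} ≤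
      Real.exp (-(T.card / (256 * Γ))) := by
  have hgm : Measurable g := measurable_of_finite g
  -- A fixed Chernoff parameter suffices. Per sample the deviation b/8 gains t·b/8 = 1/(128Γ), the
  -- second moment costs t²Γb² = 1/(256Γ), and the difference is the rate.
  set t : ℝ := 1 / (16 * (Γ * b)) with ht
  have ht0 : 0 < t := by positivity
  have hX : ∀ l, Measurable (g ∘ K l) := fun l => hgm.comp (hK l)
  have hcomp : iIndepFun (fun l => g ∘ K l) μ := hind.comp (fun _ => g) fun _ => hgm
  have hbound (k : κ) : |t * g k| ≤ 1 := by
    rw [abs_mul, abs_of_pos ht0]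
    calc t * |g k| ≤ t * (Γ * b) := mul_le_mul_of_nonneg_left (hg k) ht0.le
      _ = 1 / 16 := by rw [ht]; field_simp
      _ ≤ 1 := by norm_num
  have hsum : (∑ l ∈ T, g ∘ K l) = fun ω => ∑ l ∈ T, g (K l ω) := by
    ext ω; simp
  have hint : Integrable (fun ω => Real.exp (t * (∑ l ∈ T, g ∘ K l) ω)) μ := by
    refine Integrable.of_bound (C := Real.exp (t * (T.card * (Γ * b)))) ?_ ?_
    · refine (Real.measurable_exp.comp (Measurable.const_mul ?_ t)).aestronglyMeasurable
      rw [hsum]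
      exact Finset.measurable_sum T fun l _ => hX l
    · refine Filter.Eventually.of_forall fun ω => ?_
      rw [Real.norm_eq_abs, Real.abs_exp, hsum]
      gcongr
      calc ∑ l ∈ T, g (K l ω) ≤ ∑ l ∈ T, Γ * b :=
            Finset.sum_le_sum fun l _ => (le_abs_self _).trans (hg _)
        _ = _ := by simp
  have h := measure_ge_le_exp_mul_mgf (μ := μ) (X := ∑ l ∈ T, g ∘ K l)
    ((T.card : ℝ) * (∑ k, π k * g k + b / 8)) ht0.le hint
  rw [hcomp.mgf_sum hX] at h
  rw [hsum] at h
  refine h.trans ?_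
  calc _ ≤ Real.exp (-t * ((T.card : ℝ) * (∑ k, π k * g k + b / 8))) *
        ∏ _l ∈ T, Real.exp (t * ∑ k, π k * g k + t ^ 2 * (Γ * b ^ 2)) := by
        gcongr with l hl
        · exact fun l _ => mgf_nonneg
        · exact mgf_comp_le (hK l) (hπ l) hbound hV
    _ = Real.exp (-(T.card / (256 * Γ))) := by
        rw [Finset.prod_const, ← Real.exp_nat_mul, ← Real.exp_add]
        congr 1
        have h1 : t * b = 1 / (16 * Γ) := by rw [ht]; field_simp
        have h2 : t ^ 2 * (Γ * b ^ 2) = 1 / (256 * Γ) := by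
          rw [ht]; field_simp; norm_num
        rw [h2]
        have h3 : -t * ((T.card : ℝ) * (∑ k, π k * g k + b / 8)) =
          -(T.card * t * ∑ k, π k * g k) - T.card * (t * b) / 8 := by ring
        rw [h3, h1]
        field_simp
        ring

/-- Four one-sided tails, for both signs of the real and imaginary parts, each at deviation b/8; the
modulus is at most the sum of the two absolute parts. -/
theorem bernstein_complex {m : ℕ} {K : Fin m → Ω → κ} (hK : ∀ l, Measurable (K l))
    (hind : iIndepFun K μ) {π : κ → ℝ} (hπ : ∀ l k, μ.real (K l ⁻¹' {k}) = π k)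
    {F : κ → ℂ} {Γ b : ℝ} (hΓ : 0 < Γ) (hb : 0 < b) (hF : ∀ k, ‖F k‖ ≤ Γ * b)
    (hV : ∑ k, π k * ‖F k‖ ^ 2 ≤ Γ * b ^ 2) {T : Finset (Fin m)} (hT : 0 < T.card) {a : ℂ}
    (ha : ∑ k, (π k : ℂ) * F k = a) :
    μ.real {ω | b / 4 < ‖1 / (T.card : ℂ) * ∑ l ∈ T, F (K l ω) - a‖} ≤
      4 * Real.exp (-(T.card / (256 * Γ))) := by
  have hT' : (0 : ℝ) < T.card := by exact_mod_cast hT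
  have tail (g : κ → ℝ) (hg : ∀ k, |g k| ≤ ‖F k‖) :
      μ.real {ω | (T.card : ℝ) * (∑ k, π k * g k + b / 8) ≤ ∑ l ∈ T, g (K l ω)} ≤
        Real.exp (-(T.card / (256 * Γ))) := by
    refine bernstein_tail hK hind hπ hΓ hb (fun k => (hg k).trans (hF k)) (le_trans ?_ hV) T
    -- The weights π are known to be nonnegative only as the law of some sample, so a sample index
    -- is needed; T provides one.
    by_cases hm : Nonempty (Fin m)
    · obtain ⟨l⟩ := hm
      refine Finset.sum_le_sum fun k _ => mul_le_mul_of_nonneg_left ?_ ?_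
      · rw [← sq_abs]; gcongr; exact hg k
      · rw [← hπ l]; exact measureReal_nonneg
    · obtain ⟨l, _⟩ := Finset.card_pos.1 hT
      exact absurd ⟨l⟩ hm
  have t1 := tail (fun k => (F k).re) fun k => Complex.abs_re_le_norm _
  have t2 := tail (fun k => -(F k).re) fun k => by
    rw [abs_neg]; exact Complex.abs_re_le_norm _
  have t3 := tail (fun k => (F k).im) fun k => Complex.abs_im_le_norm _
  have t4 := tail (fun k => -(F k).im) fun k => by
    rw [abs_neg]; exact Complex.abs_im_le_norm _
  set A1 := {ω | (T.card : ℝ) * (∑ k, π k * (F k).re + b / 8) ≤ ∑ l ∈ T, (F (K l ω)).re}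
  set A2 := {ω | (T.card : ℝ) * (∑ k, π k * -(F k).re + b / 8) ≤ ∑ l ∈ T, -(F (K l ω)).re}
  set A3 := {ω | (T.card : ℝ) * (∑ k, π k * (F k).im + b / 8) ≤ ∑ l ∈ T, (F (K l ω)).im}
  set A4 := {ω | (T.card : ℝ) * (∑ k, π k * -(F k).im + b / 8) ≤ ∑ l ∈ T, -(F (K l ω)).im}
  have hsub : {ω | b / 4 < ‖1 / (T.card : ℂ) * ∑ l ∈ T, F (K l ω) - a‖} ⊆
      (A1 ∪ A2) ∪ (A3 ∪ A4) := by
    intro ω hω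
    by_contra hn
    simp only [Set.mem_union, not_or, A1, A2, A3, A4, Set.mem_ofPred_eq, not_le, mul_neg,
      Finset.sum_neg_distrib] at hn
    obtain ⟨⟨h1, h2⟩, h3, h4⟩ := hn
    have hre : a.re = ∑ k, π k * (F k).re := by
      rw [← ha, Complex.re_sum]; simp
    have him : a.im = ∑ k, π k * (F k).im := by
      rw [← ha, Complex.im_sum]; simp
    have hc : (1 / (T.card : ℂ)) = ((1 / (T.card : ℝ) : ℝ) : ℂ) := by push_cast; rfl
    rw [← hre] at h1 h2
    rw [← him] at h3 h4
    have hre' : |(1 / (T.card : ℂ) * ∑ l ∈ T, F (K l ω) - a).re| ≤ b / 8 := by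
      rw [Complex.sub_re, hc, Complex.re_ofReal_mul, Complex.re_sum, abs_le, one_div_mul_eq_div]
      constructor
      · rw [le_sub_iff_add_le, le_div_iff₀ hT']; linarith
      · rw [sub_le_iff_le_add, div_le_iff₀ hT']; linarith
    have him' : |(1 / (T.card : ℂ) * ∑ l ∈ T, F (K l ω) - a).im| ≤ b / 8 := by
      rw [Complex.sub_im, hc, Complex.im_ofReal_mul, Complex.im_sum, abs_le, one_div_mul_eq_div]
      constructor
      · rw [le_sub_iff_add_le, le_div_iff₀ hT']; linarith
      · rw [sub_le_iff_le_add, div_le_iff₀ hT']; linarith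
    have := Complex.norm_le_abs_re_add_abs_im (1 / (T.card : ℂ) * ∑ l ∈ T, F (K l ω) - a)
    rw [Set.mem_ofPred_eq] at hω
    linarith
  calc _ ≤ μ.real ((A1 ∪ A2) ∪ (A3 ∪ A4)) := measureReal_mono hsub
    _ ≤ (μ.real A1 + μ.real A2) + (μ.real A3 + μ.real A4) :=
        (measureReal_union_le _ _).trans
          (add_le_add (measureReal_union_le _ _) (measureReal_union_le _ _))
    _ ≤ _ := by linarith

/-- If a property of the samples indexed by `T` and by a disjoint `U` has small probability for
each fixed value of the former, then it has small probability. -/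
theorem measureReal_le_of_forall_fixed {m : ℕ} {K : Fin m → Ω → κ} (hK : ∀ l, Measurable (K l))
    (hind : iIndepFun K μ) {T U : Finset (Fin m)} (hTU : Disjoint T U)
    {P : (Fin m → κ) → (Fin m → κ) → Prop}
    (hT : ∀ k k₁ k', (∀ l ∈ T, k l = k₁ l) → P k k' → P k₁ k')
    (hU : ∀ k k' k₁, (∀ l ∈ U, k' l = k₁ l) → P k k' → P k k₁) {δ : ℝ}
    (h : ∀ k, μ.real {ω | P k fun l => K l ω} ≤ δ) :
    μ.real {ω | P (fun l => K l ω) fun l => K l ω} ≤ δ := by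
  classical
  obtain ⟨ω₀⟩ : Nonempty Ω := nonempty_of_isProbabilityMeasure μ
  -- Independence concerns the samples restricted to T and to U, while P takes full sample vectors.
  -- The missing coordinates are filled with arbitrary values, which P ignores.
  let ext (V : Finset (Fin m)) (a : V → κ) : Fin m → κ := fun l =>
    if hl : l ∈ V then a ⟨l, hl⟩ else K l ω₀
  let f : Ω → T → κ := fun ω l => K l ω
  let g : Ω → U → κ := fun ω l => K l ω
  have hf : Measurable f := measurable_pi_lambda _ fun l => hK l
  have hfg : f ⟂ᵢ[μ] g := hind.indepFun_finset T U hTU hK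
  have hextT (ω : Ω) (l : Fin m) (hl : l ∈ T) : K l ω = ext T (f ω) l := by simp [ext, f, hl]
  have hextU (ω : Ω) (l : Fin m) (hl : l ∈ U) : K l ω = ext U (g ω) l := by simp [ext, g, hl]
  have hB (k : Fin m → κ) :
      {ω | P k fun l => K l ω} = g ⁻¹' {c | P k (ext U c)} := by
    ext ω
    exact ⟨fun hP => hU _ _ _ (hextU ω) hP, fun hP => hU _ _ _ (fun l hl => (hextU ω l hl).symm) hP⟩
  have hsub : {ω | P (fun l => K l ω) fun l => K l ω} ⊆
      ⋃ a : T → κ, (f ⁻¹' {a} ∩ g ⁻¹' {c | P (ext T a) (ext U c)}) := by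
    intro ω hω
    rw [Set.mem_iUnion]
    refine ⟨f ω, rfl, ?_⟩
    exact hU _ _ _ (hextU ω) (hT _ _ _ (hextT ω) hω)
  calc _ ≤ ∑ a : T → κ, μ.real (f ⁻¹' {a} ∩ g ⁻¹' {c | P (ext T a) (ext U c)}) :=
        (measureReal_mono hsub).trans (measureReal_iUnion_fintype_le _)
    _ = ∑ a : T → κ, μ.real (f ⁻¹' {a}) * μ.real (g ⁻¹' {c | P (ext T a) (ext U c)}) := by
        refine Finset.sum_congr rfl fun a _ => ?_
        simp only [Measure.real]
        rw [hfg.measure_inter_preimage_eq_mul _ _ (measurableSet_singleton a)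
          (Set.toFinite _).measurableSet, ENNReal.toReal_mul]
    _ ≤ ∑ a : T → κ, μ.real (f ⁻¹' {a}) * δ := by
        refine Finset.sum_le_sum fun a _ => mul_le_mul_of_nonneg_left ?_ measureReal_nonneg
        rw [← hB]; exact h _
    _ = δ := by rw [← Finset.sum_mul, sum_measureReal_preimage hf, one_mul]

end Probability

/-! ### The golfing scheme -/

section Golfing

variable {κ ι : Type*} [DecidableEq ι]

/-- The `i`-th of the consecutive batches of `q` samples. -/
def batch (m q i : ℕ) : Finset (Fin m) :=
  Finset.univ.filter fun l => i * q ≤ (l : ℕ) ∧ (l : ℕ) < (i + 1) * q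

theorem card_batch {m q i : ℕ} (h : (i + 1) * q ≤ m) : (batch m q i).card = q := by
  have : (batch m q i).map Fin.valEmbedding = Finset.Ico (i * q) ((i + 1) * q) := by
    ext a
    simp only [batch, Finset.mem_map, Finset.mem_filter, Finset.mem_univ, true_and,
      Fin.valEmbedding_apply, Finset.mem_Ico]
    constructor
    · rintro ⟨l, hl, rfl⟩; exact hl
    · intro ha; exact ⟨⟨a, by omega⟩, ha, rfl⟩
  rw [← Finset.card_map Fin.valEmbedding, this, Nat.card_Ico, add_mul, one_mul]
  omega

/-- The empirical version of `z = 𝔼 H_K z`, from the `i`-th batch of samples. -/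
noncomputable def batchMean {m : ℕ} (H : κ → (ι → ℂ) → ι → ℂ) (q : ℕ) (k : Fin m → κ) (i : ℕ)
    (z : ι → ℂ) : ι → ℂ :=
  fun c => 1 / (q : ℂ) * ∑ l ∈ batch m q i, H (k l) z c

/-- The residuals on `S` of the golfing scheme started at `z`. -/
noncomputable def residual {m : ℕ} (H : κ → (ι → ℂ) → ι → ℂ) (S : Finset ι) (q : ℕ)
    (k : Fin m → κ) (z : ι → ℂ) : ℕ → ι → ℂ
  | 0 => z
  | i + 1 => fun c => if c ∈ S then
      residual H S q k z i c - batchMean H q k i (residual H S q k z i) c else 0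

/-- The i-th residual is a function of the first i batches only, hence independent of the batch that
is applied to it. -/
theorem residual_congr {m : ℕ} (H : κ → (ι → ℂ) → ι → ℂ) (S : Finset ι) (q : ℕ)
    (z : ι → ℂ) {k k' : Fin m → κ} (i : ℕ) (h : ∀ l : Fin m, (l : ℕ) < i * q → k l = k' l) :
    residual H S q k z i = residual H S q k' z i := by
  induction i with
  | zero => rfl
  | succ i ih =>
    have h1 := ih fun l hl => h l (hl.trans_le (Nat.mul_le_mul_right q (Nat.le_succ i)))
    funext c
    simp only [residual, h1, batchMean]
    have : ∑ l ∈ batch m q i, H (k l) (residual H S q k' z i) c =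
        ∑ l ∈ batch m q i, H (k' l) (residual H S q k' z i) c := by
      refine Finset.sum_congr rfl fun l hl => ?_
      rw [h l (Finset.mem_filter.1 hl).2.2]
    rw [this]

theorem residual_eq_zero {m : ℕ} (H : κ → (ι → ℂ) → ι → ℂ) {S : Finset ι} (q : ℕ)
    (k : Fin m → κ) {z : ι → ℂ} (hz : ∀ c ∉ S, z c = 0) (i : ℕ) :
    ∀ c ∉ S, residual H S q k z i c = 0 := by
  intro c hc
  cases i with
  | zero => exact hz c hc
  | succ i => simp [residual, hc]

/-- The failure of the `i`-th step of the golfing scheme. -/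
def GolfingFailure {m : ℕ} (H : κ → (ι → ℂ) → ι → ℂ) (S : Finset ι) (q : ℕ)
    (k : Fin m → κ) (z : ι → ℂ) (i : ℕ) : Prop :=
  (∀ c, ‖residual H S q k z i c‖ ≤ (1 / 4) ^ i) ∧
    ∃ c, (1 / 4) ^ i / 4 < ‖batchMean H q k i (residual H S q k z i) c - residual H S q k z i c‖

/-- The size bound on the residual is part of `GolfingFailure`, so the absence of failure passes the
bound from one step to the next. -/
theorem norm_residual_le {m : ℕ} (H : κ → (ι → ℂ) → ι → ℂ) {S : Finset ι} {q : ℕ}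
    {k : Fin m → κ} {z : ι → ℂ} (hz : ∀ c, ‖z c‖ ≤ 1) {L : ℕ}
    (h : ∀ i < L, ¬GolfingFailure H S q k z i) {i : ℕ} (hi : i ≤ L) (c : ι) :
    ‖residual H S q k z i c‖ ≤ (1 / 4) ^ i := by
  induction i generalizing c with
  | zero => simpa [residual] using hz c
  | succ i ih =>
    have h1 := h i (by omega)
    simp only [GolfingFailure, not_and, not_exists, not_lt] at h1
    have h2 := h1 (fun c => ih (by omega) c) c
    simp only [residual]
    split_ifs
    · rw [norm_sub_rev]
      refine h2.trans (le_of_eq ?_)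
      ring
    · rw [norm_zero]; positivity

/-- The certificate produced by `L` golfing steps. -/
noncomputable def certificate {m : ℕ} (H : κ → (ι → ℂ) → ι → ℂ) (S : Finset ι) (q : ℕ)
    (k : Fin m → κ) (z : ι → ℂ) (L : ℕ) : ι → ℂ :=
  fun c => ∑ i ∈ Finset.range L, batchMean H q k i (residual H S q k z i) c

/-- On S the increments of the residual telescope. -/
theorem certificate_sub {m : ℕ} (H : κ → (ι → ℂ) → ι → ℂ) {S : Finset ι} (q : ℕ)
    (k : Fin m → κ) (z : ι → ℂ) (L : ℕ) {c : ι} (hc : c ∈ S) :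
    z c - certificate H S q k z L c = residual H S q k z L c := by
  induction L with
  | zero => simp [certificate, residual]
  | succ L ih =>
    simp only [residual, if_pos hc, ← ih, certificate, Finset.sum_range_succ]
    ring

theorem norm_certificate_le {m : ℕ} (H : κ → (ι → ℂ) → ι → ℂ) {S : Finset ι} {q : ℕ}
    {k : Fin m → κ} {z : ι → ℂ} (hz : ∀ c, ‖z c‖ ≤ 1) (hzS : ∀ c ∉ S, z c = 0) {L : ℕ}
    (h : ∀ i < L, ¬GolfingFailure H S q k z i) {c : ι} (hc : c ∉ S) :
    ‖certificate H S q k z L c‖ ≤ 1 / 2 := by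
  -- Off S the residual vanishes, so the i-th batch mean itself is at most (1/4)^i / 4. These sum to
  -- less than 1/3; the weaker bound used here keeps a correction term that carries the induction.
  have key (n : ℕ) (hn : n ≤ L) : ‖certificate H S q k z n c‖ ≤ (1 - (1 / 4) ^ n) / 2 := by
    induction n with
    | zero => simp [certificate]
    | succ n ih =>
      have h1 := h n (by omega)
      simp only [GolfingFailure, not_and, not_exists, not_lt] at h1
      have h2 := h1 (fun c => norm_residual_le H hz h (by omega) c) c
      rw [residual_eq_zero H q k hzS n c hc, sub_zero] at h2
      have h3 := ih (by omega)
      have h4 : (0 : ℝ) < (1 / 4) ^ n := by positivity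
      simp only [certificate, Finset.sum_range_succ] at h3 ⊢
      refine (norm_add_le _ _).trans ?_
      rw [pow_succ]
      linarith
  have h4 : (0 : ℝ) < (1 / 4) ^ L := by positivity
  linarith [key L le_rfl]

/-- With the earlier batches frozen, the residual is a deterministic vector of sup norm at most b =
(1/4)^i. Bernstein then applies at each coordinate of the fresh batch, followed by a union bound. -/
theorem measureReal_golfingFailure_le {Ω : Type*} [MeasurableSpace Ω] {μ : Measure Ω}
    [IsProbabilityMeasure μ] [Fintype ι] [Fintype κ] [MeasurableSpace κ] [MeasurableSingletonClass κ]
    {m : ℕ} {K : Fin m → Ω → κ} (hK : ∀ l, Measurable (K l))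
    (hind : iIndepFun K μ) {π : κ → ℝ} (hπ : ∀ l k, μ.real (K l ⁻¹' {k}) = π k)
    {H : κ → (ι → ℂ) → ι → ℂ} {S : Finset ι} {Γ : ℝ} (hΓ : 0 < Γ)
    (hH : ∀ b z, 0 < b → (∀ c ∉ S, z c = 0) → (∀ c, ‖z c‖ ≤ b) → ∀ c,
      (∀ k, ‖H k z c‖ ≤ Γ * b) ∧ ∑ k, π k * ‖H k z c‖ ^ 2 ≤ Γ * b ^ 2 ∧
        ∑ k, (π k : ℂ) * H k z c = z c)
    {q i : ℕ} (hq : 0 < q) (hi : (i + 1) * q ≤ m) {z : ι → ℂ} (hz : ∀ c ∉ S, z c = 0) :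
    μ.real {ω | GolfingFailure H S q (fun l => K l ω) z i} ≤
      Fintype.card ι * (4 * Real.exp (-(q / (256 * Γ)))) := by
  -- The first argument feeds the residual and the second the batch mean, which separates past
  -- samples from fresh ones.
  let P : (Fin m → κ) → (Fin m → κ) → Prop := fun k k' =>
    (∀ c, ‖residual H S q k z i c‖ ≤ (1 / 4) ^ i) ∧
      ∃ c, (1 / 4) ^ i / 4 <
        ‖batchMean H q k' i (residual H S q k z i) c - residual H S q k z i c‖
  let T : Finset (Fin m) := Finset.univ.filter fun l => (l : ℕ) < i * q
  have hdisj : Disjoint T (batch m q i) := by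
    rw [Finset.disjoint_left]
    intro l h1 h2
    have h1 := (Finset.mem_filter.1 h1).2
    have h2 := (Finset.mem_filter.1 h2).2
    omega
  refine measureReal_le_of_forall_fixed (P := P) hK hind hdisj ?_ ?_ ?_
  · intro k k₁ k' hkk hP
    have := residual_congr H S q z (k := k) (k' := k₁) i fun l hl =>
      hkk l (Finset.mem_filter.2 ⟨Finset.mem_univ _, hl⟩)
    simpa only [P, this] using hP
  · intro k k' k₁ hkk hP
    have (w : ι → ℂ) (c : ι) : batchMean H q k' i w c = batchMean H q k₁ i w c := by
      unfold batchMean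
      congr 1
      exact Finset.sum_congr rfl fun l hl => by rw [hkk l hl]
    simpa only [P, this] using hP
  · intro k
    by_cases hk : ∀ c, ‖residual H S q k z i c‖ ≤ (1 / 4) ^ i
    · have hb : (0 : ℝ) < (1 / 4) ^ i := by positivity
      have hcard := card_batch hi
      have hsub : {ω | P k fun l => K l ω} ⊆ ⋃ c, {ω | (1 / 4) ^ i / 4 <
          ‖batchMean H q (fun l => K l ω) i (residual H S q k z i) c -
            residual H S q k z i c‖} := by
        rintro ω ⟨-, c, hc⟩
        exact Set.mem_iUnion.2 ⟨c, hc⟩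
      refine (measureReal_mono hsub).trans ((measureReal_iUnion_fintype_le _).trans ?_)
      rw [← nsmul_eq_mul, ← Finset.card_univ, ← Finset.sum_const]
      refine Finset.sum_le_sum fun c _ => ?_
      obtain ⟨h1, h2, h3⟩ := hH _ _ hb (residual_eq_zero H q k hz i) hk c
      have := bernstein_complex hK hind hπ hΓ hb h1 h2 (T := batch m q i) (by omega) h3
      rw [hcard] at this
      exact this
    · have : {ω | P k fun l => K l ω} = ∅ := by
        ext ω; simp only [P, Set.mem_ofPred_eq, Set.mem_empty_iff_false, iff_false]
        exact fun h => hk h.1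
      rw [this, measureReal_empty]
      positivity

/-- Inexact dual certificates for the sign pattern and for the coordinates of the support give
`ℓ¹` recovery. -/
theorem l1norm_lt_of_certificates [Fintype ι] {S : Finset ι} {x h : ι → ℂ} {η : ℝ} (hη : 0 ≤ η)
    (hηS : (S.card : ℝ) * η ≤ 1 / 4) (hx : ∀ c ∉ S, x c = 0) (hh : h ≠ 0)
    (hcert : ∀ z : ι → ℂ, (∀ c ∉ S, z c = 0) →
      (z = (fun c => x c / ‖x c‖) ∨ ∃ c ∈ S, z = Pi.single c 1) →
      ∃ v : ι → ℂ, ∑ c, star (v c) * h c = 0 ∧ (∀ c ∈ S, ‖z c - v c‖ ≤ η) ∧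
        ∀ c ∉ S, ‖v c‖ ≤ 1 / 2) :
    l1norm x < l1norm (x + h) := by
  set a := ∑ c ∈ S, ‖h c‖ with ha
  set b := ∑ c ∈ Sᶜ, ‖h c‖ with hb
  have hb0 : 0 ≤ b := Finset.sum_nonneg fun _ _ => norm_nonneg _
  have hpair (z : ι → ℂ) (hz : ∀ c ∉ S, z c = 0)
      (hz' : z = (fun c => x c / ‖x c‖) ∨ ∃ c ∈ S, z = Pi.single c 1) :
      ‖∑ c ∈ S, star (z c) * h c‖ ≤ η * a + 1 / 2 * b := by
    obtain ⟨v, hv0, hvS, hvc⟩ := hcert z hz hz'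
    have heq : ∑ c ∈ S, star (z c) * h c =
        ∑ c ∈ S, star (z c - v c) * h c - ∑ c ∈ Sᶜ, star (v c) * h c := by
      rw [← Finset.sum_add_sum_compl S] at hv0
      rw [← sub_eq_zero, ← hv0]
      simp only [star_sub, sub_mul, Finset.sum_sub_distrib]
      ring
    rw [heq]
    refine (norm_sub_le _ _).trans (add_le_add ?_ ?_)
    · rw [ha, Finset.mul_sum]
      refine norm_sum_le_of_le _ fun c hc => ?_
      rw [norm_mul, norm_star]
      exact mul_le_mul_of_nonneg_right (hvS c hc) (norm_nonneg _)
    · rw [hb, Finset.mul_sum]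
      refine norm_sum_le_of_le _ fun c hc => ?_
      rw [norm_mul, norm_star]
      exact mul_le_mul_of_nonneg_right (hvc c (Finset.mem_compl.1 hc)) (norm_nonneg _)
  -- Testing against the certificate of a single coordinate bounds that entry of h.
  have hcoord (c : ι) (hc : c ∈ S) : ‖h c‖ ≤ η * a + 1 / 2 * b := by
    have h1 := hpair (Pi.single c 1)
      (fun d hd => Pi.single_eq_of_ne (by rintro rfl; exact hd hc) _) (Or.inr ⟨c, hc, rfl⟩)
    rw [Finset.sum_eq_single_of_mem c hc fun d _ hd => by
      rw [Pi.single_eq_of_ne hd, star_zero, zero_mul]] at h1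
    simpa using h1
  have hab : a ≤ S.card * (η * a + 1 / 2 * b) := by
    rw [ha, ← nsmul_eq_mul]
    exact Finset.sum_le_card_nsmul _ _ _ hcoord
  have ha0 : 0 ≤ a := Finset.sum_nonneg fun _ _ => norm_nonneg _
  -- Summing the coordinate bounds over S gives a ≤ a/4 + |S| b/2, so a ≤ (2/3)|S| b, and |S| η ≤
  -- 1/4 yields η a ≤ b/6. The sign certificate then loses at most b/6 + b/2 < b.
  have hηa : η * a ≤ 1 / 4 * (2 / 3) * b := by
    have h1 : S.card * η * a ≤ 1 / 4 * a := mul_le_mul_of_nonneg_right hηS ha0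
    have h2 : a ≤ 2 / 3 * (S.card * b) := by nlinarith
    calc η * a ≤ η * (2 / 3 * (S.card * b)) := mul_le_mul_of_nonneg_left h2 hη
      _ = (S.card * η) * (2 / 3 * b) := by ring
      _ ≤ 1 / 4 * (2 / 3 * b) := mul_le_mul_of_nonneg_right hηS (by positivity)
      _ = _ := by ring
  have hbpos : 0 < b := by
    rcases hb0.lt_or_eq with h1 | h1
    · exact h1
    · exfalso
      apply hh
      have ha1 : a ≤ 0 := by
        rw [← h1] at hab
        nlinarith
      have hall : ∑ c, ‖h c‖ = 0 := by
        rw [← Finset.sum_add_sum_compl S, ← ha, ← hb]; linarith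
      funext c
      have := (Finset.sum_eq_zero_iff_of_nonneg fun c _ => norm_nonneg (h c)).1 hall c
        (Finset.mem_univ c)
      exact norm_eq_zero.1 this
  have hsgn := hpair (fun c => x c / ‖x c‖) (fun c hc => by simp [hx c hc]) (Or.inl rfl)
  -- Subgradient inequality for the modulus. Where x vanishes, the sign is 0 by the convention for
  -- division by zero, and the claim is 0 ≤ ‖h c‖.
  have hlow (c : ι) : ‖x c‖ + (star (x c / ‖x c‖) * h c).re ≤ ‖x c + h c‖ := by
    rcases eq_or_ne (x c) 0 with h0 | h0
    · simp [h0]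
    · have hn : (‖x c‖ : ℂ) ≠ 0 := by exact_mod_cast norm_ne_zero_iff.2 h0
      have e : star (x c / ‖x c‖) * x c = ((‖x c‖ : ℝ) : ℂ) := by
        rw [Complex.star_def, map_div₀, Complex.conj_ofReal, div_mul_eq_mul_div,
          Complex.conj_mul', div_eq_iff hn]
        ring
      calc ‖x c‖ + (star (x c / ‖x c‖) * h c).re
          = (star (x c / ‖x c‖) * (x c + h c)).re := by
            rw [mul_add, Complex.add_re, e, Complex.ofReal_re]
        _ ≤ ‖star (x c / ‖x c‖) * (x c + h c)‖ := Complex.re_le_norm _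
        _ = ‖x c + h c‖ := by
            rw [norm_mul, norm_star, norm_div, Complex.norm_real, norm_norm,
              div_self (norm_ne_zero_iff.2 h0), one_mul]
  have hlowS : ∑ c ∈ S, ‖x c‖ + (∑ c ∈ S, star (x c / ‖x c‖) * h c).re ≤
      ∑ c ∈ S, ‖x c + h c‖ := by
    rw [Complex.re_sum, ← Finset.sum_add_distrib]
    exact Finset.sum_le_sum fun c _ => hlow c
  have hre := (abs_le.1 ((Complex.abs_re_le_norm _).trans hsgn)).1
  have hx1 : l1norm x = ∑ c ∈ S, ‖x c‖ := by
    rw [l1norm, ← Finset.sum_add_sum_compl S, add_eq_left]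
    exact Finset.sum_eq_zero fun c hc => by rw [hx c (Finset.mem_compl.1 hc), norm_zero]
  have hx2 : l1norm (x + h) = ∑ c ∈ S, ‖x c + h c‖ + b := by
    rw [l1norm, ← Finset.sum_add_sum_compl S]
    congr 1
    exact Finset.sum_congr rfl fun c hc => by
      rw [Pi.add_apply, hx c (Finset.mem_compl.1 hc), zero_add]
  rw [hx1, hx2]
  linarith

end Golfing

/-! ### The sampled operators -/

/-- The `v`-th column of `z`, measured at the `k`-th frequency. -/
noncomputable def lineMeasurement {p : ℕ} (k : Fin (2 ^ p))
    (z : Fin (2 ^ p) × Fin (2 ^ p) → ℂ) (v : Fin (2 ^ p)) : ℂ :=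
  ∑ u, waveletMatrix p k u * z (u, v)

/-- The operator `B_k^* B_k / π_k`. -/
noncomputable def lineOperator {p : ℕ} (π : Fin (2 ^ p) → ℝ) (k : Fin (2 ^ p))
    (z : Fin (2 ^ p) × Fin (2 ^ p) → ℂ) : Fin (2 ^ p) × Fin (2 ^ p) → ℂ :=
  fun c => ((1 / π k : ℝ) : ℂ) * (star (waveletMatrix p k c.1) * lineMeasurement k z c.2)

theorem sum_star_mul_waveletMatrix {p : ℕ} (u u' : Fin (2 ^ p)) :
    ∑ k, star (waveletMatrix p k u) * waveletMatrix p k u' = if u = u' then 1 else 0 := by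
  have := congrFun (congrFun (conjTranspose_mul_waveletMatrix p) u) u'
  rw [Matrix.mul_apply, Matrix.one_apply] at this
  simpa only [Matrix.conjTranspose_apply] using this

theorem sum_norm_waveletMatrix_sq {p : ℕ} (u : Fin (2 ^ p)) :
    ∑ k, ‖waveletMatrix p k u‖ ^ 2 = 1 := by
  have h := sum_star_mul_waveletMatrix u u
  simp only [Complex.star_def, Complex.conj_mul', if_true] at h
  exact_mod_cast h

theorem sum_star_mul_mulVec {p : ℕ} (y : Fin (2 ^ p) → ℂ) (u : Fin (2 ^ p)) :
    ∑ k, star (waveletMatrix p k u) * ∑ u', waveletMatrix p k u' * y u' = y u := by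
  simp only [Finset.mul_sum, ← mul_assoc]
  rw [Finset.sum_comm]
  simp only [← Finset.sum_mul, sum_star_mul_waveletMatrix]
  simp

theorem sum_norm_mulVec_sq {p : ℕ} (y : Fin (2 ^ p) → ℂ) :
    ∑ k, ‖∑ u, waveletMatrix p k u * y u‖ ^ 2 = ∑ u, ‖y u‖ ^ 2 := by
  have h : ∑ k, star (∑ u, waveletMatrix p k u * y u) * (∑ u, waveletMatrix p k u * y u) =
      ∑ u, star (y u) * y u := by
    calc _ = ∑ k, ∑ u, star (y u) * (star (waveletMatrix p k u) *
          ∑ u', waveletMatrix p k u' * y u') := by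
          refine Finset.sum_congr rfl fun k _ => ?_
          rw [star_sum, Finset.sum_mul]
          refine Finset.sum_congr rfl fun u _ => ?_
          rw [star_mul', mul_assoc, mul_left_comm]
      _ = _ := by
          rw [Finset.sum_comm]
          simp only [← Finset.mul_sum, sum_star_mul_mulVec]
  simp only [Complex.star_def, Complex.conj_mul'] at h
  exact_mod_cast h

theorem norm_waveletMatrix_sq_le' {p : ℕ} (k u : Fin (2 ^ p)) :
    ‖waveletMatrix p k u‖ ^ 2 ≤ 2 * (1 / 2 ^ (level k : ℕ)) := by
  by_cases h : level k = level u
  · rw [h]; exact norm_waveletMatrix_sq_le k u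
  · rw [waveletMatrix_eq_zero h, norm_zero, zero_pow two_ne_zero]; positivity

/-! ### Estimates by the column sparsities of the support -/

section Support

variable {p : ℕ} {S : Finset (Fin (2 ^ p) × Fin (2 ^ p))}

/-- Each column belongs to one τ_ℓ', so the double maximum in `sc` ranges over all columns. -/
theorem card_le_sc (j : Fin (p + 1)) (v : Fin (2 ^ p)) :
    (Finset.univ.filter fun u : Fin (2 ^ p) => level u = j ∧ (u, v) ∈ S).card ≤ sc S j := by
  have h1 : (S ∩ Omega j (level v) ∩ column v).card ≤ sc S j := by
    unfold sc
    have hv : v ∈ tau (level v) := by simp [tau]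
    exact (Finset.le_sup (f := fun k => (S ∩ Omega j (level v) ∩ column k).card) hv).trans
      (Finset.le_sup (f := fun ℓ' : Fin (p + 1) =>
        (tau ℓ').sup fun k => (S ∩ Omega j ℓ' ∩ column k).card) (Finset.mem_univ (level v)))
  refine le_trans ?_ h1
  refine Finset.card_le_card_of_injOn (fun u => (u, v)) ?_ fun a _ b _ h => (Prod.ext_iff.1 h).1
  intro u hu
  have hu := (Finset.mem_filter.1 hu).2
  simp [Omega, tau, column, hu.1, hu.2]

theorem sc_pos {u v : Fin (2 ^ p)} (h : (u, v) ∈ S) : 0 < sc S (level u) :=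
  lt_of_lt_of_le (Finset.card_pos.2 ⟨u, by simp [h]⟩) (card_le_sc (level u) v)

variable {z : Fin (2 ^ p) × Fin (2 ^ p) → ℂ} {b : ℝ}

theorem sum_level_le (hz : ∀ c ∉ S, z c = 0) {B : ℝ} (j : Fin (p + 1)) (v : Fin (2 ^ p))
    {f : Fin (2 ^ p) → ℝ} (hf : ∀ u, level u ≠ j → f u = 0) (hf' : ∀ u, z (u, v) = 0 → f u = 0)
    (hB : ∀ u, f u ≤ B) (hB0 : 0 ≤ B) : ∑ u, f u ≤ sc S j * B := by
  have h1 : ∑ u, f u = ∑ u ∈ Finset.univ.filter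
      (fun u : Fin (2 ^ p) => level u = j ∧ (u, v) ∈ S), f u := by
    symm
    refine Finset.sum_subset (Finset.subset_univ _) fun u _ hu => ?_
    simp only [Finset.mem_filter, Finset.mem_univ, true_and, not_and] at hu
    by_cases h : level u = j
    · exact hf' u (hz _ (hu h))
    · exact hf u h
  rw [h1]
  refine (Finset.sum_le_card_nsmul _ _ B fun u _ => hB u).trans ?_
  rw [nsmul_eq_mul]
  exact mul_le_mul_of_nonneg_right (by exact_mod_cast card_le_sc j v) hB0

/-- At most s^c_j terms of the measurement are nonzero, j being the level of the line, and each
product of two matrix entries is at most 2·2^(-j) by the arithmetic-geometric mean inequality. -/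
theorem norm_mul_lineMeasurement_le (hz : ∀ c ∉ S, z c = 0) (hb : 0 ≤ b) (hzb : ∀ c, ‖z c‖ ≤ b)
    (k u v : Fin (2 ^ p)) :
    ‖waveletMatrix p k u‖ * ‖lineMeasurement k z v‖ ≤
      2 * (1 / 2 ^ (level k : ℕ)) * sc S (level k) * b := by
  calc ‖waveletMatrix p k u‖ * ‖lineMeasurement k z v‖
      ≤ ‖waveletMatrix p k u‖ * ∑ u', ‖waveletMatrix p k u' * z (u', v)‖ :=
        mul_le_mul_of_nonneg_left (norm_sum_le _ _) (norm_nonneg _)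
    _ = ∑ u', ‖waveletMatrix p k u‖ * ‖waveletMatrix p k u' * z (u', v)‖ := Finset.mul_sum _ _ _
    _ ≤ sc S (level k) * (2 * (1 / 2 ^ (level k : ℕ)) * b) := by
        refine sum_level_le hz (level k) v ?_ ?_ ?_ (by positivity)
        · intro u' hu'
          rw [waveletMatrix_eq_zero (fun h => hu' h.symm), zero_mul, norm_zero, mul_zero]
        · intro u' hu'
          rw [hu', mul_zero, norm_zero, mul_zero]
        · intro u'
          rw [norm_mul, ← mul_assoc]
          refine mul_le_mul ?_ (hzb _) (norm_nonneg _) (by positivity)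
          have h1 := norm_waveletMatrix_sq_le' k u
          have h2 := norm_waveletMatrix_sq_le' k u'
          nlinarith [sq_nonneg (‖waveletMatrix p k u‖ - ‖waveletMatrix p k u'‖)]
    _ = _ := by ring

/-- This is what allows weight zero on the levels that S does not meet. -/
theorem lineMeasurement_eq_zero (hz : ∀ c ∉ S, z c = 0) {k : Fin (2 ^ p)}
    (hk : sc S (level k) = 0) (v : Fin (2 ^ p)) : lineMeasurement k z v = 0 := by
  refine Finset.sum_eq_zero fun u _ => ?_
  by_cases h : level k = level u
  · rw [hz, mul_zero]
    intro hu
    have := sc_pos hu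
    rw [← h, hk] at this
    exact absurd this (lt_irrefl 0)
  · rw [waveletMatrix_eq_zero h, zero_mul]

/-- Parseval for the part of the column at level j. Bounding each measurement separately would give
the square of s^c_j, which is too large for the second moment in Bernstein. -/
theorem sum_norm_lineMeasurement_sq_le (hz : ∀ c ∉ S, z c = 0) (hzb : ∀ c, ‖z c‖ ≤ b)
    (j : Fin (p + 1)) (v : Fin (2 ^ p)) :
    ∑ k ∈ tau j, ‖lineMeasurement k z v‖ ^ 2 ≤ sc S j * b ^ 2 := by
  set y : Fin (2 ^ p) → ℂ := fun u => if level u = j then z (u, v) else 0 with hy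
  calc ∑ k ∈ tau j, ‖lineMeasurement k z v‖ ^ 2
      = ∑ k ∈ tau j, ‖∑ u, waveletMatrix p k u * y u‖ ^ 2 := by
        refine Finset.sum_congr rfl fun k hk => ?_
        have hk := (Finset.mem_filter.1 hk).2
        unfold lineMeasurement
        congr 2
        refine Finset.sum_congr rfl fun u _ => ?_
        simp only [hy]
        split_ifs with h
        · rfl
        · rw [waveletMatrix_eq_zero (by rw [hk]; exact fun e => h e.symm), zero_mul, zero_mul]
    _ ≤ ∑ k, ‖∑ u, waveletMatrix p k u * y u‖ ^ 2 :=
        Finset.sum_le_sum_of_subset_of_nonneg (Finset.subset_univ _) fun _ _ _ => by positivity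
    _ = ∑ u, ‖y u‖ ^ 2 := sum_norm_mulVec_sq y
    _ ≤ sc S j * b ^ 2 := by
        refine sum_level_le hz j v ?_ ?_ ?_ (by positivity)
        · intro u hu; simp [hy, hu]
        · intro u hu; simp [hy, hu]
        · intro u
          simp only [hy]
          split_ifs
          · gcongr; exact hzb _
          · simp only [norm_zero, zero_pow two_ne_zero]; positivity

variable {w : Fin (p + 1) → ℝ} {G : ℝ}

theorem lineOperator_bounds (hw : ∀ j, 0 ≤ w j) (hwS : ∀ j, 0 < sc S j → 0 < w j)
    (hG : ∀ j : Fin (p + 1), 1 / w j * (1 / 2 ^ (j : ℕ)) * (sc S j : ℝ) ≤ G)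
    (hb : 0 < b) (hz : ∀ c ∉ S, z c = 0) (hzb : ∀ c, ‖z c‖ ≤ b) (c : Fin (2 ^ p) × Fin (2 ^ p)) :
    (∀ k, ‖lineOperator (byLevel w) k z c‖ ≤ 2 * G * b) ∧
      ∑ k, byLevel w k * ‖lineOperator (byLevel w) k z c‖ ^ 2 ≤ 2 * G * b ^ 2 ∧
      ∑ k, (byLevel w k : ℂ) * lineOperator (byLevel w) k z c = z c := by
  obtain ⟨u, v⟩ := c
  have hw1 (j) : 0 ≤ 1 / w j := one_div_nonneg.2 (hw j)
  have hnorm (k) : ‖lineOperator (byLevel w) k z (u, v)‖ =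
      1 / w (level k) * (‖waveletMatrix p k u‖ * ‖lineMeasurement k z v‖) := by
    unfold lineOperator byLevel
    rw [norm_mul, norm_mul, norm_star, Complex.norm_real, Real.norm_of_nonneg (hw1 _)]
  refine ⟨fun k => ?_, ?_, ?_⟩
  · rw [hnorm]
    calc _ ≤ 1 / w (level k) * (2 * (1 / 2 ^ (level k : ℕ)) * sc S (level k) * b) :=
          mul_le_mul_of_nonneg_left (norm_mul_lineMeasurement_le hz hb.le hzb k u v) (hw1 _)
      _ = 2 * (1 / w (level k) * (1 / 2 ^ (level k : ℕ)) * sc S (level k)) * b := by ring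
      _ ≤ 2 * G * b := by
          have := hG (level k)
          gcongr
  · have hterm (k) : byLevel w k * ‖lineOperator (byLevel w) k z (u, v)‖ ^ 2 ≤
        if level k = level u then
          1 / w (level u) * (2 * (1 / 2 ^ (level u : ℕ))) * ‖lineMeasurement k z v‖ ^ 2 else 0 := by
      rw [hnorm]
      split_ifs with h
      · have e : byLevel w k * (1 / w (level k) *
            (‖waveletMatrix p k u‖ * ‖lineMeasurement k z v‖)) ^ 2 =
            1 / w (level k) * ‖waveletMatrix p k u‖ ^ 2 * ‖lineMeasurement k z v‖ ^ 2 := by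
          unfold byLevel
          -- If the weight is 0, then 1/0 = 0 makes both sides vanish.
          rcases eq_or_ne (w (level k)) 0 with h0 | h0
          · simp [h0]
          · field_simp
        rw [e, h]
        have := norm_waveletMatrix_sq_le k u
        have := hw1 (level u)
        gcongr
      · rw [waveletMatrix_eq_zero h]; simp
    calc _ ≤ ∑ k, (if level k = level u then
          1 / w (level u) * (2 * (1 / 2 ^ (level u : ℕ))) * ‖lineMeasurement k z v‖ ^ 2 else 0) :=
          Finset.sum_le_sum fun k _ => hterm k
      _ = 1 / w (level u) * (2 * (1 / 2 ^ (level u : ℕ))) *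
          ∑ k ∈ tau (level u), ‖lineMeasurement k z v‖ ^ 2 := by
          rw [← Finset.sum_filter, Finset.mul_sum]; rfl
      _ ≤ 1 / w (level u) * (2 * (1 / 2 ^ (level u : ℕ))) * (sc S (level u) * b ^ 2) := by
          have := hw1 (level u)
          have := sum_norm_lineMeasurement_sq_le hz hzb (level u) v
          gcongr
      _ = 2 * (1 / w (level u) * (1 / 2 ^ (level u : ℕ)) * sc S (level u)) * b ^ 2 := by ring
      _ ≤ 2 * G * b ^ 2 := by
          have := hG (level u)
          gcongr
  · rw [← sum_star_mul_mulVec (fun u => z (u, v)) u]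
    refine Finset.sum_congr rfl fun k _ => ?_
    change (w (level k) : ℂ) * (((1 / w (level k) : ℝ) : ℂ) *
      (star (waveletMatrix p k u) * lineMeasurement k z v)) =
        star (waveletMatrix p k u) * lineMeasurement k z v
    -- Where the weight may be 0 it cannot be cancelled, but there the measurement of z vanishes.
    by_cases h : sc S (level k) = 0
    · rw [lineMeasurement_eq_zero hz h]; simp
    · have h0 := (hwS _ (Nat.pos_of_ne_zero h)).ne'
      rw [← mul_assoc, ← Complex.ofReal_mul, mul_one_div_cancel h0, Complex.ofReal_one, one_mul]

/-- A column of the unitary matrix indexed by a point of S has squared norm 1, and its squared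
entries are at most 2G times the sampling probabilities, which sum to 1. The bound makes the
Bernstein parameter positive and absorbs the rounding of the batch length. -/
theorem one_le_of_bound (hw : IsLevelDistribution w) (hwS : ∀ j, 0 < sc S j → 0 < w j)
    (hG : ∀ j : Fin (p + 1), 1 / w j * (1 / 2 ^ (j : ℕ)) * (sc S j : ℝ) ≤ G)
    (hS : S.Nonempty) : 1 ≤ 2 * G := by
  obtain ⟨⟨u, v⟩, huv⟩ := hS
  have hsc : 0 < sc S (level u) := sc_pos huv
  have hpos := hwS _ hsc
  have hsc1 : (1 : ℝ) ≤ sc S (level u) := by exact_mod_cast hsc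
  have h1 : 1 / 2 ^ (level u : ℕ) ≤ G * w (level u) := by
    have h2 : 1 / w (level u) * (1 / 2 ^ (level u : ℕ)) * 1 ≤ G :=
      le_trans (by gcongr) (hG (level u))
    rw [mul_one, one_div_mul_eq_div, div_le_iff₀ hpos] at h2
    exact h2
  have hG0 : 0 ≤ G := by
    have : 0 < G * w (level u) := lt_of_lt_of_le (by positivity) h1
    exact (pos_of_mul_pos_left this hpos.le).le
  calc (1 : ℝ) = ∑ k, ‖waveletMatrix p k u‖ ^ 2 := (sum_norm_waveletMatrix_sq u).symm
    _ ≤ ∑ k, 2 * G * byLevel w k := by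
        refine Finset.sum_le_sum fun k _ => ?_
        by_cases h : level k = level u
        · refine (norm_waveletMatrix_sq_le k u).trans ?_
          rw [byLevel, h]; linarith
        · rw [waveletMatrix_eq_zero h, norm_zero, zero_pow two_ne_zero]
          have := hw.1 (level k)
          rw [byLevel]; positivity
    _ = 2 * G := by rw [← Finset.mul_sum, hw.2, mul_one]

end Support

/-! ### The kernel of the sensing matrix and its orthogonality to the certificates -/

theorem lineMeasurement_eq_zero_of_sensing {p m : ℕ} {π : Fin (2 ^ p) → ℝ}
    {K : Fin m → Fin (2 ^ p)} {h : Fin (2 ^ p) × Fin (2 ^ p) → ℂ} (hh : sensing π K *ᵥ h = 0)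
    {l : Fin m} (hl : 0 < π (K l)) : lineMeasurement (K l) h = 0 := by
  have hm : 0 < m := l.pos
  have hm' : (0 : ℝ) < m := by exact_mod_cast hm
  -- By the Kronecker structure, the rows of one line apply the unitary `waveletMatrix p` to the
  -- vector of column measurements. Being invertible, it can be removed.
  have hmul : waveletMatrix p *ᵥ lineMeasurement (K l) h = 0 := by
    funext i
    have h1 := congrFun hh (l, i)
    have h2 : (sensing π K *ᵥ h) (l, i) =
        ((1 / Real.sqrt m * (1 / Real.sqrt (π (K l))) : ℝ) : ℂ) *
          (waveletMatrix p *ᵥ lineMeasurement (K l) h) i := by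
      simp only [Matrix.mulVec, dotProduct, sensing, block, lineMeasurement, Finset.mul_sum]
      rw [Fintype.sum_prod_type, Finset.sum_comm]
      refine Finset.sum_congr rfl fun v _ => Finset.sum_congr rfl fun u _ => ?_
      rw [A₀_apply]
      ring
    rw [h2, Pi.zero_apply, mul_eq_zero] at h1
    rcases h1 with h1 | h1
    · exfalso
      have : (1 / Real.sqrt m * (1 / Real.sqrt (π (K l)))) ≠ 0 := by positivity
      exact this (by exact_mod_cast h1)
    · exact h1
  have h3 := congrArg (fun y => (waveletMatrix p)ᴴ *ᵥ y) hmul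
  simpa [Matrix.mulVec_mulVec, conjTranspose_mul_waveletMatrix] using h3

/-- The operator has the form B^* B / π, so its range is orthogonal to the kernel of B. For π k = 0
it is zero by the convention 1/0 = 0. -/
theorem sum_star_lineOperator_mul {p : ℕ} {π : Fin (2 ^ p) → ℝ} (hπ : ∀ k, 0 ≤ π k)
    (k : Fin (2 ^ p)) (z h : Fin (2 ^ p) × Fin (2 ^ p) → ℂ)
    (hh : 0 < π k → lineMeasurement k h = 0) :
    ∑ c, star (lineOperator π k z c) * h c = 0 := by
  rcases (hπ k).lt_or_eq with h0 | h0
  · have : ∑ c, star (lineOperator π k z c) * h c =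
        ∑ v, ((1 / π k : ℝ) : ℂ) * star (lineMeasurement k z v) * lineMeasurement k h v := by
      rw [Fintype.sum_prod_type, Finset.sum_comm]
      refine Finset.sum_congr rfl fun v _ => ?_
      have e : lineMeasurement k h v = ∑ u, waveletMatrix p k u * h (u, v) := rfl
      rw [e, Finset.mul_sum]
      refine Finset.sum_congr rfl fun u _ => ?_
      simp only [lineOperator, star_mul', Complex.star_def, Complex.conj_ofReal]
      simp only [← Complex.star_def, star_star]
      ring
    rw [this, hh h0]
    simp
  · simp [lineOperator, ← h0]

theorem sum_star_certificate_mul {p m : ℕ} {π : Fin (2 ^ p) → ℝ} (hπ : ∀ k, 0 ≤ π k)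
    {K : Fin m → Fin (2 ^ p)} {h : Fin (2 ^ p) × Fin (2 ^ p) → ℂ} (hh : sensing π K *ᵥ h = 0)
    (S : Finset (Fin (2 ^ p) × Fin (2 ^ p))) (q L : ℕ) (z : Fin (2 ^ p) × Fin (2 ^ p) → ℂ) :
    ∑ c, star (certificate (lineOperator π) S q K z L c) * h c = 0 := by
  simp only [certificate, batchMean, star_sum, star_mul', Finset.sum_mul, Finset.mul_sum]
  rw [Finset.sum_comm]
  refine Finset.sum_eq_zero fun i _ => ?_
  rw [Finset.sum_comm]
  refine Finset.sum_eq_zero fun l _ => ?_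
  simp only [mul_assoc]
  rw [← Finset.mul_sum, sum_star_lineOperator_mul hπ _ _ _
    fun hl => lineMeasurement_eq_zero_of_sensing hh hl, mul_zero]

/-! ### Recovery -/

/-- For s ≥ 2 both log₂ s and 1 are bounded by ln s / ln 2, and 2 / ln 2 < 3. -/
theorem log_two_succ_le {s : ℕ} (hs : 2 ≤ s) : ((Nat.log 2 s + 1 : ℕ) : ℝ) ≤ 3 * Real.log s := by
  have h2 : (0.6931471803 : ℝ) < Real.log 2 := Real.log_two_gt_d9
  have h1 : Real.log 2 ≤ Real.log s :=
    Real.log_le_log two_pos (by exact_mod_cast hs)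
  have h3 : (Nat.log 2 s : ℝ) * Real.log 2 ≤ Real.log s := by
    rw [← Real.log_pow]
    refine Real.log_le_log (by positivity) ?_
    exact_mod_cast Nat.pow_log_le_self 2 (by omega)
  have h0 : (0 : ℝ) ≤ Nat.log 2 s := Nat.cast_nonneg _
  push_cast
  nlinarith

/-- From s + 1 ≤ 2^L with L = log₂ s + 1, the product is at most s / (s + 1)² ≤ 1/4. This fixes the
number of golfing steps. -/
theorem mul_quarter_pow_le (s : ℕ) : (s : ℝ) * (1 / 4) ^ (Nat.log 2 s + 1) ≤ 1 / 4 := by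
  have h1 : s + 1 ≤ 2 ^ (Nat.log 2 s + 1) := Nat.lt_pow_succ_log_self one_lt_two s
  have h2 : ((s : ℝ) + 1) ≤ 2 ^ (Nat.log 2 s + 1) := by exact_mod_cast h1
  have h4 : (4 : ℝ) ^ (Nat.log 2 s + 1) = (2 ^ (Nat.log 2 s + 1)) ^ 2 := by
    rw [← pow_mul, mul_comm, pow_mul]; norm_num
  rw [one_div_pow, mul_one_div, div_le_iff₀ (by positivity), h4]
  have h0 : (0 : ℝ) ≤ s := Nat.cast_nonneg _
  nlinarith [sq_nonneg ((s : ℝ) - 1)]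

theorem isUniqueL1Solution_of_not_golfingFailure {p m : ℕ} {π : Fin (2 ^ p) → ℝ}
    (hπ : ∀ k, 0 ≤ π k) {K : Fin m → Fin (2 ^ p)} {S : Finset (Fin (2 ^ p) × Fin (2 ^ p))}
    {x : Fin (2 ^ p) × Fin (2 ^ p) → ℂ} (hx : ∀ i, i ∉ S → x i = 0) {q : ℕ}
    (h : ∀ z ∈ insert (fun c => x c / (‖x c‖ : ℂ)) (S.image fun c => Pi.single c (1 : ℂ)),
      ∀ i < Nat.log 2 S.card + 1, ¬GolfingFailure (lineOperator π) S q K z i) :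
    IsUniqueL1Solution (sensing π K) (sensing π K *ᵥ x) x := by
  refine ⟨rfl, fun z hz hne => ?_⟩
  have hker : sensing π K *ᵥ (z - x) = 0 := by rw [Matrix.mulVec_sub, hz, sub_self]
  have key : l1norm x < l1norm (x + (z - x)) := by
    refine l1norm_lt_of_certificates (S := S) (η := (1 / 4) ^ (Nat.log 2 S.card + 1))
      (by positivity) (mul_quarter_pow_le _) hx (sub_ne_zero.2 hne) fun y hy hy' => ?_
    have hmem : y ∈ insert (fun c => x c / (‖x c‖ : ℂ))
        (S.image fun c => Pi.single c (1 : ℂ)) := by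
      rcases hy' with rfl | ⟨c, hc, rfl⟩
      · exact Finset.mem_insert_self _ _
      · exact Finset.mem_insert_of_mem (Finset.mem_image_of_mem _ hc)
    have hnorm (c) : ‖y c‖ ≤ 1 := by
      rcases hy' with rfl | ⟨d, hd, rfl⟩
      · rw [norm_div, Complex.norm_real, norm_norm]
        exact div_self_le_one _
      · rcases eq_or_ne c d with rfl | hcd
        · simp
        · simp [Pi.single_eq_of_ne hcd]
    refine ⟨certificate (lineOperator π) S q K y (Nat.log 2 S.card + 1),
      sum_star_certificate_mul hπ hker S q _ y, fun c hc => ?_, fun c hc => ?_⟩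
    · rw [certificate_sub _ _ _ _ _ hc]
      exact norm_residual_le _ hnorm (h y hmem) le_rfl c
    · exact norm_certificate_le _ hnorm hy (h y hmem) hc
  rwa [add_sub_cancel] at key

theorem failure_bound_lt {N ε s L t : ℝ} (hN : 4 ≤ N) (hε : 0 < ε) (hε1 : ε < 1)
    (hs : s ≤ N) (hL : 0 ≤ L) (hLs : L ≤ s)
    (ht : 5 * Real.log (N / ε) ≤ t) :
    (s + 1) * (L * (N * (4 * Real.exp (-t)))) < ε := by
  have hN0 : 0 < N := by linarith
  have hexp : Real.exp (-t) ≤ (ε / N) ^ 5 := by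
    have h1 : Real.exp (-(5 * Real.log (N / ε))) = (ε / N) ^ 5 := by
      have : -(5 * Real.log (N / ε)) = ((5 : ℕ) : ℝ) * Real.log (ε / N) := by
        rw [← inv_div, Real.log_inv]; push_cast; ring
      rw [this, Real.exp_nat_mul, Real.exp_log (by positivity)]
    rw [← h1]
    exact Real.exp_le_exp.2 (by linarith)
  -- Starting vectors, steps and coordinates each contribute a factor of order at most N. The fifth
  -- power of ε/N leaves N² in the denominator, which beats the constant 8 since N ≥ 4.
  calc (s + 1) * (L * (N * (4 * Real.exp (-t))))
      ≤ (2 * N) * (N * (N * (4 * (ε / N) ^ 5))) := by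
        gcongr
        · linarith
        · linarith
    _ = ε * (8 * ε ^ 4 / N ^ 2) := by field_simp; ring
    _ < ε * 1 := by
        refine mul_lt_mul_of_pos_left ?_ hε
        rw [div_lt_one (by positivity)]
        have : ε ^ 4 ≤ 1 := pow_le_one₀ hε.le hε1.le
        nlinarith
    _ = ε := mul_one ε

theorem one_sub_lt_measureReal_recovery {p : ℕ} {S : Finset (Fin (2 ^ p) × Fin (2 ^ p))}
    {x : Fin (2 ^ p) × Fin (2 ^ p) → ℂ} {ε : ℝ} (hS : 2 ≤ S.card) (hx : ∀ i, i ∉ S → x i = 0)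
    (hε : 0 < ε) (hε1 : ε < 1) {w : Fin (p + 1) → ℝ} (hw : IsLevelDistribution w)
    (hwS : ∀ j, 0 < sc S j → 0 < w j) {Ω : Type*} [MeasurableSpace Ω] {μ : Measure Ω}
    [IsProbabilityMeasure μ] {m : ℕ} {K : Fin m → Ω → Fin (2 ^ p)}
    (hK : IsIIDWithLaw μ (byLevel w) K)
    (hm : 8000 * (⨆ j : Fin (p + 1), 1 / w j * (1 / 2 ^ (j : ℕ)) * (sc S j : ℝ)) *
      Real.log S.card * Real.log ((2 ^ p) ^ 2 / ε) ≤ m) :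
    1 - ε < μ.real {ω | IsUniqueL1Solution (sensing (byLevel w) fun l => K l ω)
      (sensing (byLevel w) (fun l => K l ω) *ᵥ x) x} := by
  set G : ℝ := ⨆ j : Fin (p + 1), 1 / w j * (1 / 2 ^ (j : ℕ)) * (sc S j : ℝ) with hGdef
  have hG (j : Fin (p + 1)) : 1 / w j * (1 / 2 ^ (j : ℕ)) * (sc S j : ℝ) ≤ G :=
    le_ciSup (f := fun j : Fin (p + 1) => 1 / w j * (1 / 2 ^ (j : ℕ)) * (sc S j : ℝ))
      (Set.finite_range _).bddAbove j
  have hG1 : 1 ≤ 2 * G := one_le_of_bound hw hwS hG (Finset.card_pos.1 (by omega))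
  set N : ℝ := (2 ^ p) ^ 2 with hN
  set s : ℕ := S.card with hs
  set L : ℕ := Nat.log 2 s + 1 with hL
  set q : ℕ := m / L with hq
  have hcard : Fintype.card (Fin (2 ^ p) × Fin (2 ^ p)) = (2 ^ p) ^ 2 := by
    rw [Fintype.card_prod, Fintype.card_fin, sq]
  have hsN' : s ≤ (2 ^ p) ^ 2 := hcard ▸ Finset.card_le_univ S
  have hsN : (s : ℝ) ≤ N := by rw [hN]; exact_mod_cast hsN'
  have hN4 : 4 ≤ N := by
    -- A one-pixel image cannot carry two support points.
    have hp : p ≠ 0 := by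
      rintro rfl
      rw [pow_zero, one_pow] at hsN'
      omega
    have h2 : (2 : ℝ) ≤ 2 ^ p := by
      calc (2 : ℝ) = 2 ^ 1 := (pow_one 2).symm
        _ ≤ 2 ^ p := pow_le_pow_right₀ one_le_two (Nat.one_le_iff_ne_zero.2 hp)
    rw [hN]; nlinarith
  have hlogN : 1 ≤ Real.log (N / ε) := by
    rw [Real.le_log_iff_exp_le (by positivity), le_div_iff₀ hε]
    have := Real.exp_one_lt_d9
    nlinarith
  have hL0 : (0 : ℝ) < L := by positivity
  have hLs : L ≤ s := Nat.log_lt_self 2 (by omega)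
  have hL3 : (L : ℝ) ≤ 3 * Real.log s := log_two_succ_le hS
  -- Here 1280 = 5·256: exponent 5 from `failure_bound_lt` and rate 1/(256Γ) with Γ = 2G. Since L ≤
  -- 3 ln s, the condition on m gives q + 1 > (4000/3)·2G·ln(N/ε); the 1 lost to the floor is at
  -- most 2G·ln(N/ε).
  have hqbound : 1280 * (2 * G) * Real.log (N / ε) ≤ q := by
    have h1 : (m : ℝ) < L * (q + 1) := by
      exact_mod_cast Nat.lt_mul_div_succ m (show 0 < L by positivity)
    have h2 : 8000 * G * (L / 3) * Real.log (N / ε) ≤ 8000 * G * Real.log s * Real.log (N / ε) := by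
      gcongr
      · linarith
      · linarith
    have h3 : L * (8000 * G / 3 * Real.log (N / ε)) < L * (q + 1) := by
      calc _ = 8000 * G * (L / 3) * Real.log (N / ε) := by ring
        _ ≤ m := h2.trans hm
        _ < _ := h1
    have h4 := lt_of_mul_lt_mul_left h3 hL0.le
    have h5 : 1 ≤ 2 * G * Real.log (N / ε) := by nlinarith
    linarith
  have hq0 : 0 < q := by
    have : (0 : ℝ) < q := lt_of_lt_of_le (by nlinarith) hqbound
    exact_mod_cast this
  set H := lineOperator (byLevel w) with hH
  set Z : Finset (Fin (2 ^ p) × Fin (2 ^ p) → ℂ) :=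
    insert (fun c => x c / (‖x c‖ : ℂ)) (S.image fun c => Pi.single c (1 : ℂ)) with hZ
  have hZS : ∀ z ∈ Z, ∀ c ∉ S, z c = 0 := by
    intro z hz c hc
    rcases Finset.mem_insert.1 hz with rfl | hz
    · simp [hx c hc]
    · obtain ⟨d, hd, rfl⟩ := Finset.mem_image.1 hz
      exact Pi.single_eq_of_ne (by rintro rfl; exact hc hd) _
  have hZcard : (Z.card : ℝ) ≤ s + 1 := by
    have : Z.card ≤ s + 1 :=
      (Finset.card_insert_le _ _).trans (Nat.add_le_add_right Finset.card_image_le 1)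
    exact_mod_cast this
  set good := {ω | IsUniqueL1Solution (sensing (byLevel w) fun l => K l ω)
      (sensing (byLevel w) (fun l => K l ω) *ᵥ x) x}
  set bad := ⋃ z ∈ Z, ⋃ i ∈ Finset.range L,
    {ω | GolfingFailure H S q (fun l => K l ω) z i} with hbad
  have hcover : Set.univ ⊆ good ∪ bad := by
    intro ω _
    by_cases hω : ω ∈ bad
    · exact Or.inr hω
    · left
      refine isUniqueL1Solution_of_not_golfingFailure (q := q) (fun k => hw.1 (level k)) hx
        fun z hz i hi hf => hω ?_
      simp only [hbad, Set.mem_iUnion]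
      exact ⟨z, hz, i, Finset.mem_range.2 hi, hf⟩
  have hfail (z) (hz : z ∈ Z) (i) (hi : i ∈ Finset.range L) :
      μ.real {ω | GolfingFailure H S q (fun l => K l ω) z i} ≤
        N * (4 * Real.exp (-(q / (256 * (2 * G))))) := by
    have hiq : (i + 1) * q ≤ m :=
      (Nat.mul_le_mul_right q (Finset.mem_range.1 hi)).trans (Nat.mul_div_le m L)
    have := measureReal_golfingFailure_le (H := H) (S := S) (Γ := 2 * G) hK.measurable hK.indep
      hK.law (by linarith)
      (fun b z hb hz hzb c => lineOperator_bounds hw.1 hwS hG hb hz hzb c) hq0 hiq (hZS z hz)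
    rw [hcard] at this
    push_cast at this
    exact this
  have hbadle : μ.real bad ≤ (s + 1) * (L * (N * (4 * Real.exp (-(q / (256 * (2 * G))))))) := by
    calc μ.real bad ≤ ∑ z ∈ Z, ∑ i ∈ Finset.range L,
          μ.real {ω | GolfingFailure H S q (fun l => K l ω) z i} :=
          (measureReal_biUnion_finset_le _ _).trans
            (Finset.sum_le_sum fun z _ => measureReal_biUnion_finset_le _ _)
      _ ≤ ∑ z ∈ Z, ∑ i ∈ Finset.range L, N * (4 * Real.exp (-(q / (256 * (2 * G))))) :=
          Finset.sum_le_sum fun z hz => Finset.sum_le_sum fun i hi => hfail z hz i hi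
      _ = Z.card * (L * (N * (4 * Real.exp (-(q / (256 * (2 * G))))))) := by
          simp only [Finset.sum_const, Finset.card_range, nsmul_eq_mul]
      _ ≤ _ := by gcongr
  have hlt : μ.real bad < ε := by
    refine hbadle.trans_lt (failure_bound_lt hN4 hε hε1 hsN hL0.le
      (by exact_mod_cast hLs) ?_)
    rw [le_div_iff₀ (by linarith)]
    linarith
  have hone : 1 ≤ μ.real good + μ.real bad := by
    calc (1 : ℝ) = μ.real Set.univ := probReal_univ.symm
      _ ≤ μ.real (good ∪ bad) := measureReal_mono hcover
      _ ≤ _ := measureReal_union_le _ _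
  linarith

/-! ### The adapted distribution -/

section Adapted

variable {p : ℕ} {S : Finset (Fin (2 ^ p) × Fin (2 ^ p))}

theorem adaptedWeights_denominator_pos (hS : S.Nonempty) :
    0 < ∑ k : Fin (2 ^ p), (sc S (level k) : ℝ) / 2 ^ (level k : ℕ) := by
  obtain ⟨⟨u, v⟩, huv⟩ := hS
  refine Finset.sum_pos' (fun k _ => by positivity) ⟨u, Finset.mem_univ u, ?_⟩
  have : (0 : ℝ) < sc S (level u) := by exact_mod_cast sc_pos huv
  positivity

theorem isLevelDistribution_adaptedWeights (hS : S.Nonempty) :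
    IsLevelDistribution (adaptedWeights S) := by
  have hD := adaptedWeights_denominator_pos hS
  refine ⟨fun j => div_nonneg (by positivity) hD.le, ?_⟩
  simp only [byLevel, adaptedWeights]
  rw [← Finset.sum_div, div_self hD.ne']

theorem adaptedWeights_pos (hS : S.Nonempty) {j : Fin (p + 1)} (hj : 0 < sc S j) :
    0 < adaptedWeights S j := by
  have hD := adaptedWeights_denominator_pos hS
  have : (0 : ℝ) < sc S j := by exact_mod_cast hj
  exact div_pos (by positivity) hD

theorem card_tau_le (j : Fin (p + 1)) : (tau j).card ≤ 2 ^ (j : ℕ) := by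
  rw [← Finset.card_range (2 ^ (j : ℕ))]
  refine Finset.card_le_card_of_injOn (fun u => (u : ℕ)) ?_ fun a _ b _ h => Fin.ext h
  intro u hu
  have hu : Nat.size (u : ℕ) = j := congrArg Fin.val (Finset.mem_filter.1 hu).2
  exact Finset.mem_coe.2 (Finset.mem_range.2 (Nat.size_le.1 hu.le))

/-- The weights equalize the terms: each nonzero one is the normalizing sum over lines. Grouping
that sum by level and using |τ_j| ≤ 2^j cancels the factor 2^(-j). -/
theorem iSup_adaptedWeights_le (hS : S.Nonempty) :
    (⨆ j : Fin (p + 1), 1 / adaptedWeights S j * (1 / 2 ^ (j : ℕ)) * (sc S j : ℝ)) ≤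
      ∑ j : Fin (p + 1), (sc S j : ℝ) := by
  have hD := adaptedWeights_denominator_pos hS
  have hle : ∑ k : Fin (2 ^ p), (sc S (level k) : ℝ) / 2 ^ (level k : ℕ) ≤
      ∑ j : Fin (p + 1), (sc S j : ℝ) := by
    rw [← Finset.sum_fiberwise Finset.univ (level (p := p))]
    refine Finset.sum_le_sum fun j _ => ?_
    calc ∑ k ∈ Finset.univ.filter (fun k : Fin (2 ^ p) => level k = j),
          (sc S (level k) : ℝ) / 2 ^ (level k : ℕ)
        = ∑ k ∈ tau j, (sc S j : ℝ) / 2 ^ (j : ℕ) :=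
          Finset.sum_congr rfl fun k hk => by rw [(Finset.mem_filter.1 hk).2]
      _ = (tau j).card * ((sc S j : ℝ) / 2 ^ (j : ℕ)) := by
          rw [Finset.sum_const, nsmul_eq_mul]
      _ ≤ 2 ^ (j : ℕ) * ((sc S j : ℝ) / 2 ^ (j : ℕ)) := by
          gcongr
          exact_mod_cast card_tau_le j
      _ = sc S j := by field_simp
  refine ciSup_le fun j => le_trans ?_ hle
  rcases Nat.eq_zero_or_pos (sc S j) with h | h
  · rw [h, Nat.cast_zero, mul_zero]; exact hD.le
  · have h' : (0 : ℝ) < sc S j := by exact_mod_cast h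
    rw [adaptedWeights]
    apply le_of_eq
    field_simp

end Adapted

end ShannonMRI

/-! ### The main theorem -/

theorem mainTheorem3 :
    ∃ C : ℝ, 0 < C ∧
      ∀ (p : ℕ) (S : Finset (Fin (2 ^ p) × Fin (2 ^ p))) (x : Fin (2 ^ p) × Fin (2 ^ p) → ℂ) (ε : ℝ),
        2 ≤ S.card → (∀ i, i ∉ S → x i = 0) → 0 < ε → ε < 1 →
        (∀ w : Fin (p + 1) → ℝ, IsLevelDistribution w → (∀ j, 0 < sc S j → 0 < w j) →
          ∀ (Ω : Type*) [MeasurableSpace Ω] (μ : MeasureTheory.Measure Ω)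
            [MeasureTheory.IsProbabilityMeasure μ] (m : ℕ) (K : Fin m → Ω → Fin (2 ^ p)),
            IsIIDWithLaw μ (byLevel w) K →
            C * (⨆ j : Fin (p + 1), 1 / w j * (1 / 2 ^ (j : ℕ)) * (sc S j : ℝ)) *
              Real.log S.card * Real.log ((2 ^ p) ^ 2 / ε) ≤ m →
            1 - ε < μ.real {ω | IsUniqueL1Solution (sensing (byLevel w) fun l => K l ω)
              (sensing (byLevel w) (fun l => K l ω) *ᵥ x) x}) ∧
        IsLevelDistribution (adaptedWeights S) ∧
        (∀ (Ω : Type*) [MeasurableSpace Ω] (μ : MeasureTheory.Measure Ω)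
          [MeasureTheory.IsProbabilityMeasure μ] (m : ℕ) (K : Fin m → Ω → Fin (2 ^ p)),
          IsIIDWithLaw μ (byLevel (adaptedWeights S)) K →
          C * (∑ j : Fin (p + 1), (sc S j : ℝ)) *
            Real.log S.card * Real.log ((2 ^ p) ^ 2 / ε) ≤ m →
          1 - ε < μ.real {ω | IsUniqueL1Solution (sensing (byLevel (adaptedWeights S)) fun l => K l ω)
            (sensing (byLevel (adaptedWeights S)) (fun l => K l ω) *ᵥ x) x}) := by
  -- One constant serves both parts, since the second is the first applied to the adapted weights
  -- under a stronger condition on m.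
  refine ⟨8000, by norm_num, fun p S x ε hS hx hε hε1 => ?_⟩
  have hne : S.Nonempty := Finset.card_pos.1 (by omega)
  refine ⟨fun w hw hwS Ω _ μ _ m K hK hm =>
      one_sub_lt_measureReal_recovery hS hx hε hε1 hw hwS hK hm,
    isLevelDistribution_adaptedWeights hne, fun Ω _ μ _ m K hK hm =>
      one_sub_lt_measureReal_recovery hS hx hε hε1 (isLevelDistribution_adaptedWeights hne)
        (fun j hj => adaptedWeights_pos hne hj) hK (le_trans ?_ hm)⟩
  have h1 : 0 ≤ Real.log S.card := Real.log_natCast_nonneg _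
  have h2 : 0 ≤ Real.log ((2 ^ p) ^ 2 / ε) := by
    refine Real.log_nonneg ?_
    rw [le_div_iff₀ hε]
    have : (1 : ℝ) ≤ (2 ^ p) ^ 2 := one_le_pow₀ (one_le_pow₀ one_le_two)
    linarith
  have h3 := iSup_adaptedWeights_le hne
  gcongr
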